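/- Let $R$ be a commutative ring and $f\colon X\to S=\operatorname{Spec}(R)$ a flat morphism between noetherian schemes. Let $E$ be a commutative formal Lie group over $X$, i.e. a sheaf of abelian groups on the big Zariski site of $X$ such that every point of $X$ has an affine open neighbourhood $U=\operatorname{Spec}(B)$ with an isomorphism of $U$-functors $E\times_X U\cong \operatorname{Spf}(B[[x_1,\dots,x_d]])$ (for some $d\ge 0$) under which the zero of $E(U)$ corresponds to $x_i\mapsto 0$ for all $i$. For an $R$-algebra $A$ put $T=\operatorname{Spec}(A)$, $X_A=X\times_S T$, let $\iota\colon X\times_S T_{\mathrm{red}}\to X_A$ be the base change of $T_{\mathrm{red}}\to T$, and let $\tilde E_A=\ker(E\to\iota_*E)$, a sheaf on the small Zariski site of $X_A$; that is, $\tilde E_A(U)=\ker(E(U)\to E(U\times_T T_{\mathrm{red}}))$ for every open $U\subset X_A$. A homomorphism $A\to B$ of $R$-algebras induces, by pullback along $X_B\to X_A$, maps $H^q(X_A,\tilde E_A)\to H^q(X_B,\tilde E_B)$. Let $$N_R(A)=\bigl(R\oplus \operatorname{nil}(A)\bigr)/\{(r,-r) : r\in\operatorname{nil}(R)\},\qquad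 (r,n)(r',n')=(rr',\,rn'+r'n+nn'),$$ where $\operatorname{nil}$ denotes the nilradical; $N_R$ is a functor from $R$-algebras to $R$-algebras, and $(r,n)\mapsto r+n$ is a natural homomorphism $N_R(A)\to A$. Then for every $q\ge 0$ and every noetherian $R$-algebra $A$ the map $$H^q\bigl(X_{N_R(A)},\tilde E_{N_R(A)}\bigr)\longrightarrow H^q\bigl(X_A,\tilde E_A\bigr)$$ induced by $N_R(A)\to A$ is an isomorphism of abelian groups, and it is functorial in $A$: for every homomorphism $A\to B$ of noetherian $R$-algebras, these maps for $A$ and $B$ commute with the maps on cohomology induced by $A\to B$ and by $N_R(A)\to N_R(B)$. -/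

import Mathlib

open CategoryTheory Limits AlgebraicGeometry TopologicalSpace Opposite

universe u

noncomputable section

namespace DeformationCohomology

section NilpotentHull

variable (R : Type u) [CommRing R] (A : Type u) [CommRing A] [Algebra R A]

instance : IsScalarTower R (nilradical A) (nilradical A) :=
  ⟨fun r x y => Subtype.ext (smul_mul_assoc r (x : A) (y : A))⟩

instance : SMulCommClass R (nilradical A) (nilradical A) :=
  ⟨fun r x y => Subtype.ext (mul_smul_comm r (x : A) (y : A)).symm⟩

/-- The ideal `{(r, -r) ; r ∈ nil(R)}` of `R ⊕ nil(A)`. Here `R ⊕ nil(A)` is Mathlib's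
`Unitization`, with product `(r, n) * (r', n') = (r r', r n' + r' n + n n')`. -/
def nilRelations : Ideal (Unitization R (nilradical A)) where
  carrier := {x | x.fst ∈ nilradical R ∧ (x.snd : A) = -algebraMap R A x.fst}
  zero_mem' := by simp
  add_mem' := by
    rintro x y ⟨hx, hx'⟩ ⟨hy, hy'⟩
    refine ⟨by simpa using Ideal.add_mem _ hx hy, ?_⟩
    simp [hx', hy']
    ring
  smul_mem' := by
    rintro c x ⟨hx, hx'⟩
    refine ⟨by simpa using Ideal.mul_mem_left _ _ hx, ?_⟩
    simp [hx', Algebra.smul_def]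
    ring

/-- `N_R(A) = R ⊕ nil(A) / {(r, -r) ; r ∈ nil(R)}`. -/
abbrev NilHull : Type u := Unitization R (nilradical A) ⧸ nilRelations R A

/-- The inclusion `nil(A) → A`. -/
def nilInclusion : nilradical A →ₙₐ[R] A where
  toFun n := n
  map_smul' _ _ := rfl
  map_zero' := rfl
  map_add' _ _ := rfl
  map_mul' _ _ := rfl

/-- The natural map `N_R(A) → A`, `(r, n) ↦ r + n`. -/
def NilHull.toAlgebra : NilHull R A →ₐ[R] A :=
  Ideal.Quotient.liftₐ (nilRelations R A) (Unitization.lift (nilInclusion R A)) (by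
    rintro x ⟨-, hx⟩
    simp [nilInclusion, hx])

variable {R A} {B : Type u} [CommRing B] [Algebra R B]

/-- The map `nil(A) → nil(B)` induced by a homomorphism of `R`-algebras. -/
def nilMap (φ : A →ₐ[R] B) : nilradical A →ₙₐ[R] nilradical B where
  toFun n := ⟨φ n, IsNilpotent.map n.2 φ⟩
  map_smul' _ _ := Subtype.ext (by simp)
  map_zero' := Subtype.ext (by simp)
  map_add' _ _ := Subtype.ext (by simp)
  map_mul' _ _ := Subtype.ext (by simp)

/-- Functoriality of `N_R`: the map `(r, n) ↦ (r, φ n)`. -/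
def NilHull.map (φ : A →ₐ[R] B) : NilHull R A →ₐ[R] NilHull R B :=
  Ideal.quotientMapₐ (nilRelations R B)
    (Unitization.lift ((Unitization.inrNonUnitalAlgHom R (nilradical B)).comp (nilMap φ))) (by
      rintro x ⟨hx, hx'⟩
      refine ⟨by simpa [Unitization.algebraMap_eq_inl] using hx, ?_⟩
      simp [nilMap, hx', Unitization.algebraMap_eq_inl])

/-- The map `A / nil(A) → B / nil(B)` induced by a homomorphism of `R`-algebras. -/
def redMap (φ : A →ₐ[R] B) : (A ⧸ nilradical A) →ₐ[R] (B ⧸ nilradical B) :=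
  Ideal.quotientMapₐ (nilradical B) φ (fun _ hx => IsNilpotent.map hx φ)

end NilpotentHull

section BigZariski

/-- Sheaves of abelian groups on the big Zariski site of `X`. -/
abbrev BigSheaf (X : Scheme.{u}) := Sheaf (Scheme.zariskiTopology.over X) AddCommGrpCat.{u}

/-- Sheaves of abelian groups on the small Zariski site of `X`. -/
abbrev SmallSheaf (X : Scheme.{u}) := Sheaf (Opens.grothendieckTopology X) AddCommGrpCat.{u}

lemma hom_restrictFunctor_ext {Y : Scheme.{u}} {W : Over Y} {U : Y.Opens}
    (f g : W ⟶ Y.restrictFunctor.obj U) : f = g := by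
  apply Over.OverMorphism.ext
  exact (cancel_mono U.ι).1 ((Over.w f).trans (Over.w g).symm)

instance restrictFunctor_isContinuous (Y : Scheme.{u}) :
    Y.restrictFunctor.IsContinuous (Opens.grothendieckTopology Y)
      (Scheme.zariskiTopology.over Y) := by
  refine Functor.isContinuous_of_coverPreserving ⟨?_⟩ ⟨?_⟩
  · intro F Z T x hx Y₁ Y₂ W f₁ f₂ g₁ g₂ hg₁ hg₂ h
    have h₁ : f₁.left ≫ Scheme.Opens.ι Y₁ = W.hom := Over.w f₁
    have h₂ : f₂.left ≫ Scheme.Opens.ι Y₂ = W.hom := Over.w f₂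
    let V : Y.Opens := Y₁ ⊓ Y₂
    let w : W.left ⟶ Y := W.hom
    have hr : Set.range w ⊆ Set.range V.ι := by
      rw [Scheme.Opens.range_ι]
      rintro _ ⟨z, rfl⟩
      refine ⟨?_, ?_⟩
      · rw [show w = _ from h₁.symm]; exact (f₁.left z).2
      · rw [show w = _ from h₂.symm]; exact (f₂.left z).2
    let l : W.left ⟶ V := IsOpenImmersion.lift V.ι w hr
    let k : W ⟶ Y.restrictFunctor.obj V := Over.homMk l (IsOpenImmersion.lift_fac V.ι w hr)
    have e₁ : f₁ = k ≫ Y.restrictFunctor.map (homOfLE inf_le_left : V ⟶ Y₁) :=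
      hom_restrictFunctor_ext _ _
    have e₂ : f₂ = k ≫ Y.restrictFunctor.map (homOfLE inf_le_right : V ⟶ Y₂) :=
      hom_restrictFunctor_ext _ _
    have := hx (homOfLE inf_le_left : V ⟶ Y₁) (homOfLE inf_le_right : V ⟶ Y₂)
      hg₁ hg₂ (Subsingleton.elim _ _)
    rw [e₁, e₂]
    simp only [op_comp, Functor.map_comp, types_comp_apply]
    exact congrArg (F.obj.map k.op) this
  · intro U S hS
    rw [GrothendieckTopology.mem_over_iff, Scheme.mem_grothendieckTopology_iff]
    let U' : Y.Opens := U
    choose V f hf hxV using fun x : U' => hS x.1 x.2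
    let 𝒰 : Scheme.OpenCover.{u} U' :=
      { I₀ := U'
        X := fun x => (V x : Y.Opens)
        f := fun x => Y.homOfLE (f x).le
        mem₀ := by
          rw [Scheme.presieve₀_mem_precoverage_iff]
          refine ⟨fun x => ⟨x, ⟨x.1, hxV x⟩, ?_⟩, fun x => inferInstance⟩
          exact Subtype.ext (by simp) }
    have hw (x : U') : 𝟙 _ ≫ Scheme.Opens.ι (V x) = Y.homOfLE (f x).le ≫ U.ι := by
      rw [Scheme.homOfLE_ι, Category.id_comp]
    refine ⟨𝒰, ?_⟩
    rintro - - ⟨x⟩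
    rw [Sieve.overEquiv_iff]
    exact ⟨V x, f x, Over.homMk (𝟙 _) (hw x), hf x, hom_restrictFunctor_ext _ _⟩

variable {X Y Y' : Scheme.{u}}

/-- The functor sending an open `U` of an `X`-scheme `Y` to the `X`-scheme `U`. -/
abbrev opensOver (p : Y ⟶ X) : Y.Opens ⥤ Over X := Y.restrictFunctor ⋙ Over.map p

instance opensOver_isContinuous (p : Y ⟶ X) :
    (opensOver p).IsContinuous (Opens.grothendieckTopology Y) (Scheme.zariskiTopology.over X) :=
  Functor.isContinuous_comp _ _ _ (Scheme.zariskiTopology.over Y) _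

/-- The restriction of a sheaf on the big Zariski site of `X` to the small Zariski site of an
`X`-scheme `Y`. -/
def restrictSmall (E : BigSheaf X) (p : Y ⟶ X) : SmallSheaf Y :=
  ((opensOver p).sheafPushforwardContinuous AddCommGrpCat.{u} (Opens.grothendieckTopology Y)
    (Scheme.zariskiTopology.over X)).obj E

/-- Direct image of sheaves on small Zariski sites. -/
abbrev directImage (h : Y' ⟶ Y) : SmallSheaf Y' ⥤ SmallSheaf Y :=
  (Opens.map h.base).sheafPushforwardContinuous AddCommGrpCat.{u}
    (Opens.grothendieckTopology Y) (Opens.grothendieckTopology Y')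

/-- Inverse image of sheaves on small Zariski sites. -/
abbrev inverseImage (h : Y' ⟶ Y) : SmallSheaf Y ⥤ SmallSheaf Y' :=
  (Opens.map h.base).sheafPullback AddCommGrpCat.{u}
    (Opens.grothendieckTopology Y) (Opens.grothendieckTopology Y')

/-- Inverse image is left adjoint to direct image. -/
abbrev imageAdjunction (h : Y' ⟶ Y) : inverseImage h ⊣ directImage h :=
  (Opens.map h.base).sheafAdjunctionContinuous AddCommGrpCat.{u}
    (Opens.grothendieckTopology Y) (Opens.grothendieckTopology Y')

/-- For a morphism `h : Y' ⟶ Y` of `X`-schemes and an open `U` of `Y`, the morphism of `X`-schemes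
`h⁻¹ U ⟶ U`. -/
def preimageOver {p : Y ⟶ X} {p' : Y' ⟶ X} (h : Y' ⟶ Y) (w : h ≫ p = p') (U : Y.Opens) :
    (opensOver p').obj (h ⁻¹ᵁ U) ⟶ (opensOver p).obj U :=
  Over.homMk (h ∣_ U) (by
    subst w
    exact morphismRestrict_ι_assoc h U p)

lemma preimageOver_naturality {p : Y ⟶ X} {p' : Y' ⟶ X} (h : Y' ⟶ Y) (w : h ≫ p = p')
    {U V : Y.Opens} (i : V ⟶ U) :
    preimageOver h w V ≫ (opensOver p).map i =
      (opensOver p').map ((Opens.map h.base).map i) ≫ preimageOver h w U := by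
  ext1
  change h ∣_ V ≫ Y.homOfLE i.le =
    Y'.homOfLE ((Opens.map h.base).map i).le ≫ h ∣_ U
  rw [← cancel_mono U.ι]
  simp

/-- For a morphism `h : Y' ⟶ Y` of `X`-schemes, the map `E|_Y ⟶ h_* (E|_Y')` which is given on an
open `U` of `Y` by restriction `E(U) ⟶ E(h⁻¹ U)`. -/
def restrictSmallMap (E : BigSheaf X) {p : Y ⟶ X} {p' : Y' ⟶ X} (h : Y' ⟶ Y) (w : h ≫ p = p') :
    restrictSmall E p ⟶ (directImage h).obj (restrictSmall E p') where
  hom :=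
    { app U := E.obj.map (preimageOver h w U.unop).op
      naturality U V i := by
        change E.obj.map _ ≫ E.obj.map _ = E.obj.map _ ≫ E.obj.map _
        rw [← E.obj.map_comp, ← E.obj.map_comp]
        congr 1
        exact congrArg Quiver.Hom.op (preimageOver_naturality h w i.unop) }

end BigZariski

section Cohomology

variable {Y Y' : Scheme.{u}}

instance inverseImage_preservesFiniteLimits (h : Y' ⟶ Y) :
    PreservesFiniteLimits (inverseImage h) := by
  have : RepresentablyFlat (Opens.map h.base) := inferInstance
  exact CategoryTheory.Functor.SmallCategories.instPreservesFiniteLimitsSheafSheafPullbackOfRepresentablyFlat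
    (Opens.map h.base) AddCommGrpCat.{u} (Opens.grothendieckTopology Y)
    (Opens.grothendieckTopology Y')

instance inverseImage_preservesFiniteColimits (h : Y' ⟶ Y) :
    PreservesFiniteColimits (inverseImage h) :=
  have := (imageAdjunction h).leftAdjoint_preservesColimits
  inferInstance

instance inverseImage_additive (h : Y' ⟶ Y) : (inverseImage h).Additive :=
  Functor.additive_of_preserves_binary_products _

/-- The constant sheaf `ℤ` on the small Zariski site of `Y`. -/
abbrev constZ (Y : Scheme.{u}) : SmallSheaf Y :=
  (constantSheaf (Opens.grothendieckTopology Y) AddCommGrpCat.{u}).obj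
    (AddCommGrpCat.of (ULift.{u} ℤ))

/-- The canonical map `ℤ ⟶ h⁻¹ ℤ` of sheaves on `Y'`; it corresponds to the global section of
`h⁻¹ ℤ` which is the inverse image of the section `1` of `ℤ` on `Y`. -/
def constZMap (h : Y' ⟶ Y) : constZ Y' ⟶ (inverseImage h).obj (constZ Y) :=
  ((constantSheafAdj (Opens.grothendieckTopology Y') AddCommGrpCat.{u}
    (isTerminalTop : IsTerminal (⊤ : Y'.Opens))).homEquiv _ _).symm
    ((constantSheafAdj (Opens.grothendieckTopology Y) AddCommGrpCat.{u}
      (isTerminalTop : IsTerminal (⊤ : Y.Opens))).unit.app (AddCommGrpCat.of (ULift.{u} ℤ)) ≫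
        ((imageAdjunction h).unit.app (constZ Y)).hom.app (op ⊤))

/-- For `h : Y' ⟶ Y`, sheaves `F` on `Y` and `G` on `Y'`, and a map `α : h⁻¹ F ⟶ G`, the induced
map `H^q(Y, F) → H^q(Y', h⁻¹ F) → H^q(Y', G)`. -/
def cohomologyMap (h : Y' ⟶ Y) {F : SmallSheaf Y} {G : SmallSheaf Y'}
    (α : (inverseImage h).obj F ⟶ G) (q : ℕ) : Sheaf.H.{u} F q →+ Sheaf.H.{u} G q :=
  (Sheaf.H.map α q).comp
    (((Abelian.Ext.mk₀ (constZMap h)).precomp ((inverseImage h).obj F) (zero_add q)).comp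
      ((inverseImage h).mapExtAddHom (constZ Y) F q))

end Cohomology

section FormalLieGroup

/-- The functor of points on `V`-schemes of the formal scheme `Spf(B[[x_1, …, x_d]])`, where
`V = Spec B` is affine. A morphism `Z ⟶ Spf(B[[x_1, …, x_d]])` over `V` is a homomorphism of
`B`-algebras `B[[x_1, …, x_d]] → Γ(Z, 𝒪_Z)` which is continuous for the `(x_1, …, x_d)`-adic
topology on the source and the pseudo-discrete topology on the target, i.e. which locally on `Z`
kills a power of the ideal `(x_1, …, x_d)`. -/
def formalSpace (V : Scheme.{u}) (d : ℕ) : (Over V)ᵒᵖ ⥤ Type u where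
  obj Z := {φ : MvPowerSeries (Fin d) Γ(V, ⊤) →+* Γ(Z.unop.left, ⊤) //
    φ.comp MvPowerSeries.C = Z.unop.hom.appTop.hom ∧
    ∀ z : Z.unop.left, ∃ W : Z.unop.left.Opens, z ∈ W ∧ ∃ n : ℕ,
      ∀ s ∈ (Ideal.span (Set.range (MvPowerSeries.X : Fin d → MvPowerSeries (Fin d) Γ(V, ⊤)))) ^ n,
        Z.unop.left.presheaf.map (homOfLE le_top : W ⟶ ⊤).op (φ s) = 0}
  map {Z Z'} h := ↾fun φ => ⟨h.unop.left.appTop.hom.comp φ.1, by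
    rw [RingHom.comp_assoc, φ.2.1, ← Over.w h.unop, Scheme.Hom.comp_appTop]
    rfl, by
    intro z
    obtain ⟨W, hz, n, hn⟩ := φ.2.2 (h.unop.left z)
    refine ⟨h.unop.left ⁻¹ᵁ W, hz, n, fun s hs => ?_⟩
    have := ConcreteCategory.congr_hom
      (h.unop.left.naturality (homOfLE le_top : W ⟶ ⊤).op) (φ.1 s)
    simp only [CommRingCat.comp_apply, hn s hs, map_zero] at this
    exact this.symm⟩
  map_id Z := by
    ext φ s
    simp
  map_comp g h := by
    ext φ s
    simp only [unop_comp, Over.comp_left, Scheme.Hom.comp_appTop]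
    rfl

/-- A sheaf `E` of abelian groups on the big Zariski site of `X` is a commutative formal Lie group
over `X` if every point of `X` has an affine open neighbourhood `U = Spec B` over which `E` is
isomorphic, as a sheaf of sets, to `Spf(B[[x_1, …, x_d]])` for some `d`, in such a way that
the zero of `E(U)` corresponds to `x_i ↦ 0`. -/
def IsFormalLieGroup {X : Scheme.{u}} (E : BigSheaf X) : Prop :=
  ∀ x : X, ∃ U : X.Opens, x ∈ U ∧ IsAffineOpen U ∧ ∃ d : ℕ,
    ∃ e : (Over.map U.ι).op ⋙ E.obj ⋙ forget AddCommGrpCat.{u} ≅ formalSpace U d,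
      ∀ i : Fin d, (e.hom.app (op (Over.mk (𝟙 (U : Scheme.{u}))))
        (0 : E.obj.obj (op ((Over.map U.ι).obj (Over.mk (𝟙 (U : Scheme.{u}))))))).1
          (MvPowerSeries.X i) = 0

end FormalLieGroup

section Deformation

variable {R : Type u} [CommRing R] {X : Scheme.{u}} (f : X ⟶ Spec (.of R)) (E : BigSheaf X)
variable (A : Type u) [CommRing A] [Algebra R A]
variable {B : Type u} [CommRing B] [Algebra R B] {C : Type u} [CommRing C] [Algebra R C]

/-- The base change `X_A = X ×_{Spec R} Spec A`. -/
abbrev baseChange : Scheme.{u} := pullback f (Spec.map (CommRingCat.ofHom (algebraMap R A)))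

/-- The projection `X_A ⟶ X`. -/
abbrev baseChangeFst : baseChange f A ⟶ X := pullback.fst _ _

variable {A}

/-- The morphism `X_B ⟶ X_A` induced by a homomorphism `A → B` of `R`-algebras. -/
def baseChangeMap (φ : A →ₐ[R] B) : baseChange f B ⟶ baseChange f A :=
  pullback.lift (pullback.fst _ _) (pullback.snd _ _ ≫ Spec.map (CommRingCat.ofHom φ.toRingHom)) (by
    rw [pullback.condition, Category.assoc, ← Spec.map_comp, ← CommRingCat.ofHom_comp]
    congr 3
    exact φ.comp_algebraMap.symm)

lemma baseChangeMap_fst (φ : A →ₐ[R] B) :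
    baseChangeMap f φ ≫ baseChangeFst f A = baseChangeFst f B :=
  pullback.lift_fst _ _ _

lemma baseChangeMap_comp (φ : A →ₐ[R] B) (ψ : B →ₐ[R] C) :
    baseChangeMap f ψ ≫ baseChangeMap f φ = baseChangeMap f (ψ.comp φ) := by
  apply pullback.hom_ext
  · rw [Category.assoc, baseChangeMap_fst, baseChangeMap_fst, baseChangeMap_fst]
  · simp only [baseChangeMap, Category.assoc, pullback.lift_snd, pullback.lift_snd_assoc]
    rw [← Spec.map_comp, ← CommRingCat.ofHom_comp]
    rfl

variable (A)

/-- The closed immersion `ι : X ×_S T_red ⟶ X ×_S T` for `S = Spec R` and `T = Spec A`. -/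
abbrev redInclusion : baseChange f (A ⧸ nilradical A) ⟶ baseChange f A :=
  baseChangeMap f (Ideal.Quotient.mkₐ R (nilradical A))

/-- The restriction map `E ⟶ ι_* E` of sheaves on `X_A`. -/
abbrev redRestriction : restrictSmall E (baseChangeFst f A) ⟶
    (directImage (redInclusion f A)).obj (restrictSmall E (baseChangeFst f (A ⧸ nilradical A))) :=
  restrictSmallMap E (redInclusion f A) (baseChangeMap_fst f _)

/-- The sheaf `Ẽ_T = ker(E ⟶ ι_* E)` on the small Zariski site of `X_T`, where `T = Spec A`. -/
def tildeSheaf : SmallSheaf (baseChange f A) := kernel (redRestriction f E A)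

/-- The inclusion of `Ẽ_T` into the restriction of `E` to `X_T`. -/
def tildeSheafι : tildeSheaf f E A ⟶ restrictSmall E (baseChangeFst f A) :=
  kernel.ι (redRestriction f E A)

variable {A}

lemma comp_map_comp_map_eq_zero (P : (Over X)ᵒᵖ ⥤ AddCommGrpCat.{u}) {M : AddCommGrpCat.{u}}
    {a b c d : Over X} (t : M ⟶ P.obj (op a)) (i : b ⟶ a) (j : c ⟶ b) (k : c ⟶ d) (r : d ⟶ a)
    (h : t ≫ P.map r.op = 0) (w : j ≫ i = k ≫ r) : (t ≫ P.map i.op) ≫ P.map j.op = 0 := by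
  rw [Category.assoc, ← P.map_comp, ← op_comp, w, op_comp, P.map_comp, reassoc_of% h, zero_comp]

lemma tildeSheaf_condition (φ : A →ₐ[R] B) :
    (tildeSheafι f E A ≫
      restrictSmallMap E (baseChangeMap f φ) (baseChangeMap_fst f φ)) ≫
        (directImage (baseChangeMap f φ)).map (redRestriction f E B) = 0 := by
  apply Sheaf.hom_ext
  apply NatTrans.ext
  funext U
  let V : (baseChange f A).Opens := U.unop
  let π := baseChangeMap f φ
  let ρ := baseChangeMap f (redMap φ)
  have hcomm : redInclusion f B ≫ π = ρ ≫ redInclusion f A := by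
    rw [baseChangeMap_comp, baseChangeMap_comp]
    rfl
  have h0 : (tildeSheafι f E A).hom.app U ≫
      E.obj.map (preimageOver (redInclusion f A) (baseChangeMap_fst f _) V).op = 0 :=
    congrArg (fun t => t.hom.app U) (kernel.condition (redRestriction f E A))
  let W : (baseChange f (B ⧸ nilradical B)).Opens := redInclusion f B ⁻¹ᵁ π ⁻¹ᵁ V
  let W' : (baseChange f (A ⧸ nilradical A)).Opens := redInclusion f A ⁻¹ᵁ V
  have hr : Set.range (W.ι ≫ ρ) ⊆ Set.range W'.ι := by
    rw [Scheme.Opens.range_ι]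
    rintro _ ⟨z, rfl⟩
    have hz : (redInclusion f B ≫ π) z.1 ∈ V := z.2
    rw [hcomm] at hz
    exact hz
  let l : (W : Scheme.{u}) ⟶ W' := IsOpenImmersion.lift W'.ι (W.ι ≫ ρ) hr
  have hl : l ≫ W'.ι = W.ι ≫ ρ := IsOpenImmersion.lift_fac W'.ι (W.ι ≫ ρ) hr
  let k : (opensOver (baseChangeFst f (B ⧸ nilradical B))).obj W ⟶
      (opensOver (baseChangeFst f (A ⧸ nilradical A))).obj W' := Over.homMk l (by
    change l ≫ W'.ι ≫ baseChangeFst f _ = W.ι ≫ baseChangeFst f _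
    rw [← Category.assoc, hl, Category.assoc, baseChangeMap_fst])
  have hk : preimageOver (redInclusion f B) (baseChangeMap_fst f _) (π ⁻¹ᵁ V) ≫
      preimageOver π (baseChangeMap_fst f φ) V =
        k ≫ preimageOver (redInclusion f A) (baseChangeMap_fst f _) V := by
    ext1
    change redInclusion f B ∣_ (π ⁻¹ᵁ V) ≫ π ∣_ V = l ≫ redInclusion f A ∣_ V
    rw [← cancel_mono V.ι]
    simp only [Category.assoc, morphismRestrict_ι]
    rw [← Category.assoc l, hl, morphismRestrict_ι_assoc, Category.assoc, ← hcomm]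
  exact comp_map_comp_map_eq_zero E.obj _ _ _ _ _ h0 hk

/-- For `T' = Spec B ⟶ T = Spec A`, the natural map from the inverse image of `Ẽ_T` to `Ẽ_T'`; it
is induced by the restriction maps `E(U) ⟶ E(U ×_T T')`. -/
def tildeSheafMap (φ : A →ₐ[R] B) :
    (inverseImage (baseChangeMap f φ)).obj (tildeSheaf f E A) ⟶ tildeSheaf f E B :=
  kernel.lift _ (((imageAdjunction (baseChangeMap f φ)).homEquiv _ _).symm
    (tildeSheafι f E A ≫
      restrictSmallMap E (baseChangeMap f φ) (baseChangeMap_fst f φ))) (by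
    rw [← Adjunction.homEquiv_naturality_right_symm, tildeSheaf_condition,
      Adjunction.homEquiv_counit]
    simp)

variable (A)

/-- `H^q(X_A, Ẽ_{Spec A})`. -/
abbrev deformationH (q : ℕ) : Type u := Sheaf.H.{u} (tildeSheaf f E A) q

variable {A}

/-- The map `H^q(X_A, Ẽ_{Spec A}) → H^q(X_B, Ẽ_{Spec B})` induced by a homomorphism `A → B` of
`R`-algebras. -/
def deformationHMap (φ : A →ₐ[R] B) (q : ℕ) : deformationH f E A q →+ deformationH f E B q :=
  cohomologyMap (baseChangeMap f φ) (tildeSheafMap f E φ) q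

variable (A)

/-- The map `H^q(X_{N_R(A)}, Ẽ) → H^q(X_A, Ẽ)` induced by `N_R(A) → A`. -/
def nilHullComparison (q : ℕ) : deformationH f E (NilHull R A) q →+ deformationH f E A q :=
  deformationHMap f E (NilHull.toAlgebra R A) q

end Deformation

end DeformationCohomology

end

open DeformationCohomology

/-! Over an affine open `W` of `X_A` on which `E` has coordinates, the sections of `Ẽ_A` are the
tuples of elements of `nil(A) Γ(W)`. As the group law is addition of coordinates up to products,
Čech cocycles split by successive approximation modulo the powers of `nil(A)`, so `Ẽ_A` is acyclic
on `W` if `nil(A)` is nilpotent. Let `N = N_R(A)` and let `π : X_A ⟶ X_N` be the projection, which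
is affine. Since `f` is flat and `nil(N) ≅ nil(A)`, also `nil(N) Γ(W) ≅ nil(A) Γ(π⁻¹ W)` for affine
opens `W` of `X_N`; hence `Ẽ_N ≅ π_* Ẽ_A`, and `H^q(X_N, π_* Ẽ_A) ≅ H^q(X_A, Ẽ_A)` because `Ẽ_A` is
acyclic on the opens `π⁻¹ W`. -/

noncomputable section

namespace DeformationCohomology

open Abelian

section Ext

universe w w' w'' v v' v'' t t' t''

variable {C : Type t} [Category.{v} C] [Abelian C] [HasExt.{w} C]
  {D : Type t'} [Category.{v'} D] [Abelian D] [HasExt.{w'} D]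
  {D' : Type t''} [Category.{v''} D'] [Abelian D'] [HasExt.{w''} D']

lemma ext_comp_extClass_surjective {S : ShortComplex C} (hS : S.ShortExact) [Injective S.X₂]
    (X : C) (n : ℕ) :
    Function.Surjective fun y : Ext.{w} X S.X₃ n => y.comp hS.extClass rfl := fun x =>
  Ext.covariant_sequence_exact₁ X hS x (Ext.eq_zero_of_injective _) rfl

lemma ext_induction_injective [EnoughInjectives C] {X : C}
    {motive : ∀ (Y : C) (n : ℕ), Ext.{w} X Y n → Prop}
    (zero : ∀ (Y : C) (f : X ⟶ Y), motive Y 0 (Ext.mk₀ f))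
    (succ : ∀ (S : ShortComplex C) (hS : S.ShortExact) (n : ℕ) (y : Ext.{w} X S.X₃ n),
      Injective S.X₂ → motive S.X₃ n y → motive S.X₁ (n + 1) (y.comp hS.extClass rfl))
    {Y : C} {n : ℕ} (x : Ext.{w} X Y n) : motive Y n x := by
  induction n generalizing Y with
  | zero =>
    obtain ⟨f, rfl⟩ := (Ext.mk₀_bijective X Y).2 x
    exact zero Y f
  | succ n ih =>
    let I : InjectivePresentation Y := Classical.arbitrary _
    have : Injective I.shortComplex.X₂ := I.injective
    obtain ⟨y, rfl⟩ := ext_comp_extClass_surjective I.shortExact_shortComplex X n x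
    exact succ I.shortComplex I.shortExact_shortComplex n y this (ih y)

lemma mapExactFunctor_naturality [EnoughInjectives C] {L₁ L₂ : C ⥤ D} [L₁.Additive] [L₂.Additive]
    [PreservesFiniteLimits L₁] [PreservesFiniteColimits L₁]
    [PreservesFiniteLimits L₂] [PreservesFiniteColimits L₂] (τ : L₁ ⟶ L₂) {X Y : C} {n : ℕ}
    (x : Ext.{w} X Y n) :
    (x.mapExactFunctor L₁ : Ext.{w'} _ _ n).comp (Ext.mk₀ (τ.app Y)) (add_zero n) =
      (Ext.mk₀ (τ.app X)).comp (x.mapExactFunctor L₂) (zero_add n) := by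
  induction x using ext_induction_injective with
  | zero Y f => simp [Ext.mapExactFunctor_mk₀]
  | succ S hS n y _ ih =>
    have extClass_naturality : (hS.extClass.mapExactFunctor L₁ : Ext.{w'} _ _ 1).comp
        (Ext.mk₀ (τ.app S.X₁)) (add_zero 1) =
        (Ext.mk₀ (τ.app S.X₃)).comp (hS.extClass.mapExactFunctor L₂) (zero_add 1) := by
      rw [Ext.mapExactFunctor_extClass, Ext.mapExactFunctor_extClass]
      exact (hS.map_of_exact L₁).extClass_naturality (hS.map_of_exact L₂) (S.mapNatTrans τ)
    rw [Ext.mapExactFunctor_comp, Ext.mapExactFunctor_comp, Ext.comp_assoc_of_third_deg_zero,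
      extClass_naturality, ← Ext.comp_assoc_of_second_deg_zero, ih,
      Ext.comp_assoc _ _ _ (zero_add n) rfl (by lia)]

lemma mapExactFunctor_mapExactFunctor [EnoughInjectives C] (L : C ⥤ D) (L' : D ⥤ D') [L.Additive]
    [L'.Additive] [PreservesFiniteLimits L] [PreservesFiniteColimits L]
    [PreservesFiniteLimits L'] [PreservesFiniteColimits L'] {X Y : C} {n : ℕ}
    (x : Ext.{w} X Y n) :
    ((x.mapExactFunctor L : Ext.{w'} _ _ n).mapExactFunctor L' : Ext.{w''} _ _ n) =
      x.mapExactFunctor (L ⋙ L') := by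
  induction x using ext_induction_injective with
  | zero Y f => simp [Ext.mapExactFunctor_mk₀]
  | succ S hS n y _ ih =>
    have mapExactFunctor_extClass :
        ((hS.extClass.mapExactFunctor L : Ext.{w'} _ _ 1).mapExactFunctor L' : Ext.{w''} _ _ 1) =
          hS.extClass.mapExactFunctor (L ⋙ L') := by
      rw [Ext.mapExactFunctor_extClass, Ext.mapExactFunctor_extClass]
      exact Ext.mapExactFunctor_extClass L' (hS.map_of_exact L)
    simp only [Ext.mapExactFunctor_comp, mapExactFunctor_extClass, ih]

variable {L : C ⥤ D} {G : D ⥤ C} (adj : L ⊣ G) [L.Additive] [PreservesFiniteLimits L]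
  [PreservesFiniteColimits L]

/-- The map `Ext(X, G F) → Ext(L X, F)` given by an adjunction `L ⊣ G` with exact left adjoint `L`:
apply `L`, then the counit `L G F ⟶ F`. -/
def extAdjunctionMap (X : C) (F : D) (n : ℕ) : Ext.{w} X (G.obj F) n →+ Ext.{w'} (L.obj X) F n :=
  ((Ext.mk₀ (adj.counit.app F)).postcomp _ (add_zero _)).comp (L.mapExtAddHom _ _ _)

lemma extAdjunctionMap_apply {X : C} {F : D} {n : ℕ} (x : Ext.{w} X (G.obj F) n) :
    (extAdjunctionMap adj X F n x : Ext.{w'} _ _ n) =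
      (x.mapExactFunctor L).comp (Ext.mk₀ (adj.counit.app F)) (add_zero n) := rfl

lemma extAdjunctionMap_mk₀ {X : C} {F : D} (f : X ⟶ G.obj F) :
    (extAdjunctionMap adj X F 0 (Ext.mk₀ f) : Ext.{w'} _ _ 0) =
      Ext.mk₀ ((adj.homEquiv X F).symm f) := by
  simp [extAdjunctionMap_apply, Ext.mapExactFunctor_mk₀, Adjunction.homEquiv_counit]

lemma extAdjunctionMap_zero_bijective (X : C) (F : D) :
    Function.Bijective (extAdjunctionMap.{w, w'} adj X F 0) := by
  rw [← Function.Bijective.of_comp_iff _ (Ext.mk₀_bijective X (G.obj F)),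
    show extAdjunctionMap adj X F 0 ∘ Ext.mk₀ = Ext.mk₀ ∘ (adj.homEquiv X F).symm from
      funext (extAdjunctionMap_mk₀ adj)]
  exact (Ext.mk₀_bijective _ _).comp (Equiv.bijective _)

lemma extAdjunctionMap_comp_mk₀ {X : C} {F F' : D} {n : ℕ} (x : Ext.{w} X (G.obj F) n)
    (f : F ⟶ F') :
    (extAdjunctionMap adj X F' n (x.comp (Ext.mk₀ (G.map f)) (add_zero n)) : Ext.{w'} _ _ n) =
      (extAdjunctionMap adj X F n x).comp (Ext.mk₀ f) (add_zero n) := by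
  have counit_naturality := adj.counit_naturality f
  simp only [extAdjunctionMap_apply, Ext.mapExactFunctor_comp, Ext.mapExactFunctor_mk₀,
    Ext.comp_assoc_of_third_deg_zero, Ext.mk₀_comp_mk₀, counit_naturality]

variable [G.Additive]

lemma extAdjunctionMap_comp_extClass {X : C} {n : ℕ} {S : ShortComplex D} (hS : S.ShortExact)
    (hGS : (S.map G).ShortExact) (x : Ext.{w} X (G.obj S.X₃) n) :
    (extAdjunctionMap adj X S.X₁ (n + 1) (x.comp hGS.extClass rfl) : Ext.{w'} _ _ (n + 1)) =
      (extAdjunctionMap adj X S.X₃ n x).comp hS.extClass rfl := by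
  let e : Ext.{w} (G.obj S.X₃) (G.obj S.X₁) 1 := hGS.extClass
  let counit : (S.map G).map L ⟶ S :=
    { τ₁ := adj.counit.app _, τ₂ := adj.counit.app _, τ₃ := adj.counit.app _
      comm₁₂ := (adj.counit.naturality S.f).symm
      comm₂₃ := (adj.counit.naturality S.g).symm }
  have extClass_naturality :
      (e.mapExactFunctor L : Ext.{w'} _ _ 1).comp (Ext.mk₀ (adj.counit.app S.X₁)) (add_zero 1) =
        (Ext.mk₀ (adj.counit.app S.X₃)).comp hS.extClass (zero_add 1) :=
    (congrArg (fun z => z.comp (Ext.mk₀ (adj.counit.app S.X₁)) (add_zero 1))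
      (Ext.mapExactFunctor_extClass L hGS)).trans
        ((hGS.map_of_exact L).extClass_naturality hS counit)
  change extAdjunctionMap adj X S.X₁ (n + 1) (x.comp e rfl) = _
  rw [extAdjunctionMap_apply, extAdjunctionMap_apply, Ext.mapExactFunctor_comp,
    Ext.comp_assoc_of_third_deg_zero, extClass_naturality, ← Ext.comp_assoc_of_second_deg_zero]

theorem extAdjunctionMap_bijective [EnoughInjectives D] (P : ObjectProperty D)
    (injective : ∀ I, Injective I → P I)
    (cokernel : ∀ S : ShortComplex D, S.ShortExact → Injective S.X₂ → P S.X₁ → P S.X₃)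
    (epi_map : ∀ S : ShortComplex D, S.ShortExact → Injective S.X₂ → P S.X₁ → Epi (G.map S.g))
    (X : C) {F : D} (hF : P F) (n : ℕ) :
    Function.Bijective (extAdjunctionMap.{w, w'} adj X F n) := by
  induction n generalizing F with
  | zero => exact extAdjunctionMap_zero_bijective adj X F
  | succ n ih =>
    let I : InjectivePresentation F := Classical.arbitrary _
    let S := I.shortComplex
    have hS : S.ShortExact := I.shortExact_shortComplex
    have hI : Injective S.X₂ := I.injective
    have := adj.rightAdjoint_preservesLimits
    have leftExact := ((Functor.preservesFiniteLimits_tfae G).out 3 1 rfl rfl).1 inferInstance S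
      ⟨hS.exact, hS.mono_f⟩
    have hGS : (S.map G).ShortExact :=
      { exact := leftExact.1, mono_f := leftExact.2, epi_g := epi_map S hS hI hF }
    have : Injective (S.map G).X₂ := Injective.injective_of_adjoint adj S.X₂
    exact AddMonoidHom.bijective_of_surjective_of_bijective_of_right_exact
      ((Ext.mk₀ (S.map G).g).postcomp X (add_zero n)) (hGS.extClass.postcomp X rfl)
      ((Ext.mk₀ S.g).postcomp (L.obj X) (add_zero n)) (hS.extClass.postcomp (L.obj X) rfl)
      (extAdjunctionMap adj X S.X₂ n) (extAdjunctionMap adj X S.X₃ n) _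
      (by ext x; exact (extAdjunctionMap_comp_mk₀ adj x S.g).symm)
      (by ext x; exact (extAdjunctionMap_comp_extClass adj hS hGS x).symm)
      ((ShortComplex.ab_exact_iff_function_exact _).1
        (Ext.covariant_sequence_exact₃' X hGS n (n + 1) rfl))
      ((ShortComplex.ab_exact_iff_function_exact _).1
        (Ext.covariant_sequence_exact₃' (L.obj X) hS n (n + 1) rfl))
      (ih (injective _ hI)).2 (ih (cokernel S hS hI hF))
      (ext_comp_extClass_surjective hGS X n) (ext_comp_extClass_surjective hS (L.obj X) n)

end Ext

section FunctorialityOfCohomology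

variable {Y Y' Y'' : Scheme.{u}}

/-- Maps from the constant sheaf `ℤ` to `F` correspond to global sections of `F`. -/
abbrev constZHomEquiv (F : SmallSheaf Y) :
    (constZ Y ⟶ F) ≃ (AddCommGrpCat.of (ULift.{u} ℤ) ⟶ F.obj.obj (op (⊤ : Y.Opens))) :=
  (constantSheafAdj (Opens.grothendieckTopology Y) AddCommGrpCat.{u}
    (isTerminalTop : IsTerminal (⊤ : Y.Opens))).homEquiv _ F

lemma constZHomEquiv_constZMap_comp (h : Y' ⟶ Y) {F : SmallSheaf Y'}
    (α : (inverseImage h).obj (constZ Y) ⟶ F) :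
    constZHomEquiv F (constZMap h ≫ α) =
      constZHomEquiv ((directImage h).obj F) ((imageAdjunction h).homEquiv _ _ α) := by
  have constZHomEquiv_constZMap : constZHomEquiv _ (constZMap h) = constZHomEquiv _
      ((imageAdjunction h).unit.app (constZ Y)) :=
    (Equiv.apply_symm_apply _ _).trans (Adjunction.homEquiv_unit _ _ _ _).symm
  rw [Adjunction.homEquiv_naturality_right, constZHomEquiv_constZMap,
    (imageAdjunction h).homEquiv_unit]
  exact ((constantSheafAdj (Opens.grothendieckTopology Y) AddCommGrpCat.{u}
    (isTerminalTop : IsTerminal (⊤ : Y.Opens))).homEquiv_naturality_right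
      ((imageAdjunction h).unit.app (constZ Y)) ((directImage h).map α)).symm

instance constZMap_isIso (h : Y' ⟶ Y) : IsIso (constZMap h) := by
  rw [isIso_iff_coyoneda_map_bijective]
  intro F
  refine (Function.Bijective.of_comp_iff' (constZHomEquiv F).bijective _).1 ?_
  have transpose : constZHomEquiv F ∘ (fun α : (inverseImage h).obj (constZ Y) ⟶ F =>
      constZMap h ≫ α) =
        constZHomEquiv ((directImage h).obj F) ∘ (imageAdjunction h).homEquiv _ F :=
    funext fun α => constZHomEquiv_constZMap_comp h α
  rw [transpose]
  exact (Equiv.bijective _).comp (Equiv.bijective _)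

/-- The isomorphism `(h' ≫ h)⁻¹ ≅ h'⁻¹ h⁻¹` of inverse image functors. -/
def inverseImageComp (h : Y' ⟶ Y) (h' : Y'' ⟶ Y') :
    inverseImage (h' ≫ h) ≅ inverseImage h ⋙ inverseImage h' :=
  (imageAdjunction (h' ≫ h)).leftAdjointUniq ((imageAdjunction h).comp (imageAdjunction h'))

lemma homEquiv_inverseImageComp_comp (h : Y' ⟶ Y) (h' : Y'' ⟶ Y') {F : SmallSheaf Y}
    {K : SmallSheaf Y''} (β : (inverseImage h').obj ((inverseImage h).obj F) ⟶ K) :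
    (imageAdjunction (h' ≫ h)).homEquiv F K ((inverseImageComp h h').hom.app F ≫ β) =
      (imageAdjunction h).homEquiv _ _ ((imageAdjunction h').homEquiv _ _ β) := by
  rw [Adjunction.homEquiv_naturality_right,
    show (imageAdjunction (h' ≫ h)).homEquiv _ _ ((inverseImageComp h h').hom.app F) = _ from
      Adjunction.homEquiv_leftAdjointUniq_hom_app _ _ F]
  refine (((imageAdjunction h).comp (imageAdjunction h')).homEquiv_unit F K _).symm.trans ?_
  rw [Adjunction.comp_homEquiv]
  rfl

lemma homEquiv_inverseImageComp_comp_comp (h : Y' ⟶ Y) (h' : Y'' ⟶ Y') {F : SmallSheaf Y}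
    {G : SmallSheaf Y'} {K : SmallSheaf Y''} (α : (inverseImage h).obj F ⟶ G)
    (β : (inverseImage h').obj G ⟶ K) :
    (imageAdjunction (h' ≫ h)).homEquiv F K
        ((inverseImageComp h h').hom.app F ≫ (inverseImage h').map α ≫ β) =
      (imageAdjunction h).homEquiv _ _ α ≫
        (directImage h).map ((imageAdjunction h').homEquiv _ _ β) := by
  rw [homEquiv_inverseImageComp_comp, Adjunction.homEquiv_naturality_left,
    Adjunction.homEquiv_naturality_right]

lemma constZMap_comp (h : Y' ⟶ Y) (h' : Y'' ⟶ Y') :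
    constZMap (h' ≫ h) ≫ (inverseImageComp h h').hom.app (constZ Y) =
      constZMap h' ≫ (inverseImage h').map (constZMap h) := by
  apply (constZHomEquiv _).injective
  let unit := (imageAdjunction h).homEquiv (constZ Y) _ ((imageAdjunction h').homEquiv _ _ (𝟙 _))
  have left_transpose :
      constZHomEquiv _ (constZMap (h' ≫ h) ≫ (inverseImageComp h h').hom.app (constZ Y)) =
        constZHomEquiv _ unit := by
    rw [← Category.comp_id ((inverseImageComp h h').hom.app _)]
    exact (constZHomEquiv_constZMap_comp (h' ≫ h) _).trans
      (congrArg (constZHomEquiv ((directImage (h' ≫ h)).obj _))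
        (homEquiv_inverseImageComp_comp h h' _))
  have right_transpose :
      constZHomEquiv _ (constZMap h' ≫ (inverseImage h').map (constZMap h)) =
        constZHomEquiv _ unit := by
    rw [constZHomEquiv_constZMap_comp, ← Category.comp_id ((inverseImage h').map _),
      Adjunction.homEquiv_naturality_left]
    exact constZHomEquiv_constZMap_comp h _
  exact left_transpose.trans right_transpose.symm

lemma cohomologyMap_apply (h : Y' ⟶ Y) {F : SmallSheaf Y} {G : SmallSheaf Y'}
    (α : (inverseImage h).obj F ⟶ G) (q : ℕ) (x : Sheaf.H.{u} F q) :
    cohomologyMap h α q x =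
      ((Ext.mk₀ (constZMap h)).comp (x.mapExactFunctor (inverseImage h)) (zero_add q)).comp
        (Ext.mk₀ α) (add_zero q) := rfl

lemma cohomologyMap_comp (h : Y' ⟶ Y) (h' : Y'' ⟶ Y') {F : SmallSheaf Y} {G : SmallSheaf Y'}
    {K : SmallSheaf Y''} (α : (inverseImage h).obj F ⟶ G) (β : (inverseImage h').obj G ⟶ K)
    (q : ℕ) (x : Sheaf.H.{u} F q) :
    cohomologyMap (h' ≫ h) ((inverseImageComp h h').hom.app F ≫ (inverseImage h').map α ≫ β) q x =
      cohomologyMap h' β q (cohomologyMap h α q x) := by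
  simp only [cohomologyMap_apply, Ext.mapExactFunctor_comp, Ext.mapExactFunctor_mk₀]
  rw [mapExactFunctor_mapExactFunctor, ← Ext.mk₀_comp_mk₀, ← Ext.mk₀_comp_mk₀]
  simp only [← Ext.comp_assoc_of_third_deg_zero, ← Ext.comp_assoc_of_second_deg_zero]
  rw [Ext.comp_assoc_of_third_deg_zero _ _ (Ext.mk₀ ((inverseImageComp h h').hom.app F)),
    mapExactFunctor_naturality (inverseImageComp h h').hom x,
    ← Ext.comp_assoc_of_second_deg_zero, Ext.mk₀_comp_mk₀, Ext.mk₀_comp_mk₀, constZMap_comp]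

lemma cohomologyMap_eq_extAdjunctionMap (h : Y' ⟶ Y) {F : SmallSheaf Y} {G : SmallSheaf Y'}
    (α : (inverseImage h).obj F ⟶ G) (q : ℕ) (x : Sheaf.H.{u} F q) :
    cohomologyMap h α q x = (Ext.mk₀ (constZMap h)).comp
      (extAdjunctionMap (imageAdjunction h) (constZ Y) G q
        (Sheaf.H.map ((imageAdjunction h).homEquiv _ _ α) q x)) (zero_add q) := by
  obtain ⟨θ, rfl⟩ := ((imageAdjunction h).homEquiv F G).symm.surjective α
  rw [Equiv.apply_symm_apply, Adjunction.homEquiv_counit, cohomologyMap_apply,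
    extAdjunctionMap_apply, Sheaf.H.map_apply, Ext.mapExactFunctor_comp, Ext.mapExactFunctor_mk₀,
    Ext.comp_assoc_of_third_deg_zero, Ext.comp_assoc_of_third_deg_zero, Ext.mk₀_comp_mk₀]

end FunctorialityOfCohomology

section CohomologyOfOpens

variable {Y : Scheme.{u}}

/-- The functor sending an open `V` to the sheaf `ℤ[V]` of abelian groups generated freely by a
section over `V`. -/
abbrev freeSheaf (Y : Scheme.{u}) : Y.Opens ⥤ SmallSheaf Y :=
  yoneda ⋙ (Functor.whiskeringRight _ _ _).obj AddCommGrpCat.free ⋙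
    presheafToSheaf (Opens.grothendieckTopology Y) AddCommGrpCat.{u}

/-- Maps from `ℤ[V]` to `F` correspond to sections of `F` over `V`. -/
def freeSheafHomEquiv (V : Y.Opens) (F : SmallSheaf Y) :
    ((freeSheaf Y).obj V ⟶ F) ≃ F.obj.obj (op V) :=
  ((sheafificationAdjunction (Opens.grothendieckTopology Y) AddCommGrpCat.{u}).homEquiv _ F).trans
    (((AddCommGrpCat.adj.whiskerRight (Y.Opens)ᵒᵖ).homEquiv (yoneda.obj V) F.obj).trans yonedaEquiv)

variable {F G : SmallSheaf Y} {V W : Y.Opens}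

lemma freeSheafHomEquiv_comp (s : (freeSheaf Y).obj V ⟶ F) (g : F ⟶ G) :
    freeSheafHomEquiv V G (s ≫ g) = g.hom.app (op V) (freeSheafHomEquiv V F s) := by
  simp only [freeSheafHomEquiv, Equiv.trans_apply, Adjunction.homEquiv_naturality_right]
  rfl

lemma freeSheafHomEquiv_map_comp (i : V ⟶ W) (s : (freeSheaf Y).obj W ⟶ F) :
    freeSheafHomEquiv V F ((freeSheaf Y).map i ≫ s) =
      F.obj.map i.op (freeSheafHomEquiv W F s) := by
  simp only [freeSheafHomEquiv, Equiv.trans_apply, freeSheaf, Functor.comp_map,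
    Functor.whiskeringRight_obj_map, Adjunction.homEquiv_naturality_left]
  have free_naturality := (AddCommGrpCat.adj.whiskerRight (Y.Opens)ᵒᵖ).homEquiv_naturality_left
    (yoneda.map i) (((sheafificationAdjunction (Opens.grothendieckTopology Y)
      AddCommGrpCat.{u}).homEquiv _ F) s)
  exact (congrArg yonedaEquiv free_naturality).trans (yonedaEquiv_naturality _ _).symm

lemma freeSheafHomEquiv_add (s t : (freeSheaf Y).obj V ⟶ F) :
    freeSheafHomEquiv V F (s + t) = freeSheafHomEquiv V F s + freeSheafHomEquiv V F t := by
  have apply_eq (r : (freeSheaf Y).obj V ⟶ F) :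
      freeSheafHomEquiv V F r = r.hom.app (op V) (freeSheafHomEquiv V _ (𝟙 _)) := by
    rw [← freeSheafHomEquiv_comp, Category.id_comp]
  rw [apply_eq s, apply_eq t, apply_eq (s + t)]
  rfl

/-- The cohomology group `Hⁿ(V, F)` of an open `V`, as `Extⁿ(ℤ[V], F)`. -/
abbrev cohomologyOn (F : SmallSheaf Y) (n : ℕ) (V : Y.Opens) : Type u :=
  Ext.{u} ((freeSheaf Y).obj V) F n

/-- The restriction map `Hⁿ(W, F) → Hⁿ(V, F)` for opens `V ≤ W`. -/
def cohomologyOnRes (F : SmallSheaf Y) (n : ℕ) (i : V ≤ W) :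
    cohomologyOn F n W →+ cohomologyOn F n V :=
  (Ext.mk₀ ((freeSheaf Y).map (homOfLE i))).precomp F (zero_add n)

lemma cohomologyOnRes_apply {n : ℕ} (i : V ≤ W) (x : cohomologyOn F n W) :
    cohomologyOnRes F n i x =
      (Ext.mk₀ ((freeSheaf Y).map (homOfLE i))).comp x (zero_add n) := rfl

lemma cohomologyOnRes_refl {n : ℕ} (x : cohomologyOn F n W) :
    cohomologyOnRes F n le_rfl x = x := by
  rw [cohomologyOnRes_apply, show homOfLE (le_refl W) = 𝟙 W from rfl,
    CategoryTheory.Functor.map_id, Ext.mk₀_id_comp]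

lemma cohomologyOnRes_cohomologyOnRes {n : ℕ} {U : Y.Opens} (i : U ≤ V) (j : V ≤ W)
    (x : cohomologyOn F n W) :
    cohomologyOnRes F n i (cohomologyOnRes F n j x) = cohomologyOnRes F n (i.trans j) x := by
  simp only [cohomologyOnRes_apply, Ext.mk₀_comp_mk₀_assoc, ← Functor.map_comp, homOfLE_comp]

lemma cohomologyOnRes_eq_zero_of_le {n : ℕ} {U : Y.Opens} (i : U ≤ V) (j : V ≤ W)
    {x : cohomologyOn F n W} (hx : cohomologyOnRes F n j x = 0) :
    cohomologyOnRes F n (i.trans j) x = 0 := by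
  rw [← cohomologyOnRes_cohomologyOnRes i j, hx, map_zero]

lemma cohomologyOnRes_comp {n m k : ℕ} (i : V ≤ W) (x : cohomologyOn F n W) (e : Ext.{u} F G m)
    (h : n + m = k) :
    cohomologyOnRes G k i (x.comp e h) = (cohomologyOnRes F n i x).comp e h := by
  rw [cohomologyOnRes_apply, cohomologyOnRes_apply, Ext.comp_assoc _ _ _ (zero_add n) h (by lia)]

/-- `H⁰(V, F)` is the group of sections of `F` over `V`. -/
def cohomologyOnZeroEquiv (F : SmallSheaf Y) (V : Y.Opens) :
    cohomologyOn F 0 V ≃+ F.obj.obj (op V) :=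
  Ext.addEquiv₀.trans { freeSheafHomEquiv V F with map_add' := freeSheafHomEquiv_add }

lemma cohomologyOnZeroEquiv_mk₀ (s : (freeSheaf Y).obj V ⟶ F) :
    cohomologyOnZeroEquiv F V (Ext.mk₀ s) = freeSheafHomEquiv V F s :=
  congrArg (freeSheafHomEquiv V F) (Ext.homEquiv₀.apply_symm_apply s)

lemma cohomologyOnZeroEquiv_comp_mk₀ (x : cohomologyOn F 0 V) (g : F ⟶ G) :
    cohomologyOnZeroEquiv G V (x.comp (Ext.mk₀ g) (add_zero 0)) =
      g.hom.app (op V) (cohomologyOnZeroEquiv F V x) := by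
  obtain ⟨s, rfl⟩ := (Ext.mk₀_bijective _ _).2 x
  rw [Ext.mk₀_comp_mk₀, cohomologyOnZeroEquiv_mk₀, cohomologyOnZeroEquiv_mk₀,
    freeSheafHomEquiv_comp]

lemma cohomologyOnZeroEquiv_cohomologyOnRes (i : V ≤ W) (x : cohomologyOn F 0 W) :
    cohomologyOnZeroEquiv F V (cohomologyOnRes F 0 i x) =
      F.obj.map (homOfLE i).op (cohomologyOnZeroEquiv F W x) := by
  obtain ⟨s, rfl⟩ := (Ext.mk₀_bijective _ _).2 x
  rw [cohomologyOnRes_apply, Ext.mk₀_comp_mk₀, cohomologyOnZeroEquiv_mk₀,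
    cohomologyOnZeroEquiv_mk₀, freeSheafHomEquiv_map_comp]

instance (F : SmallSheaf Y) (n : ℕ) : Subsingleton (cohomologyOn F n (⊥ : Y.Opens)) := by
  have subsingleton_sections (G : SmallSheaf Y) : Subsingleton (G.obj.obj (op (⊥ : Y.Opens))) :=
    AddCommGrpCat.subsingleton_of_isZero
      (TopCat.Sheaf.isTerminalOfEmpty (X := Y.toTopCat) G).isZero
  have id_eq_zero : 𝟙 ((freeSheaf Y).obj (⊥ : Y.Opens)) = 0 :=
    (freeSheafHomEquiv ⊥ _).injective (Subsingleton.elim _ _)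
  refine subsingleton_of_forall_eq 0 fun x => ?_
  rw [← Ext.mk₀_id_comp x, id_eq_zero, Ext.mk₀_zero, Ext.zero_comp]

lemma app_surjective_of_subsingleton_cohomologyOn {S : ShortComplex (SmallSheaf Y)}
    (hS : S.ShortExact) (hV : Subsingleton (cohomologyOn S.X₁ 1 V)) :
    Function.Surjective (S.g.hom.app (op V)) := by
  intro s
  obtain ⟨x, rfl⟩ := (cohomologyOnZeroEquiv S.X₃ V).surjective s
  obtain ⟨z, rfl⟩ := Ext.covariant_sequence_exact₃ _ hS x (zero_add 1) (Subsingleton.elim _ _)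
  exact ⟨cohomologyOnZeroEquiv S.X₂ V z, (cohomologyOnZeroEquiv_comp_mk₀ z S.g).symm⟩

lemma exists_cohomologyOnRes_eq_zero {n : ℕ} (x : cohomologyOn F (n + 1) W) {y : Y} (hy : y ∈ W) :
    ∃ (V : Y.Opens) (i : V ≤ W), y ∈ V ∧ cohomologyOnRes F (n + 1) i x = 0 := by
  induction n generalizing F with
  | zero =>
    let I : InjectivePresentation F := Classical.arbitrary _
    have : Injective I.shortComplex.X₂ := I.injective
    have hS := I.shortExact_shortComplex
    obtain ⟨x, rfl⟩ := ext_comp_extClass_surjective hS _ 0 x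
    have locallySurjective := (TopCat.Presheaf.isLocallySurjective_iff (X := Y.toTopCat) _).1
      ((TopCat.Sheaf.isLocallySurjective_iff_epi (X := Y.toTopCat) I.shortComplex.g).2 hS.epi_g)
    obtain ⟨V, i, ⟨t, ht⟩, hyV⟩ := locallySurjective W (cohomologyOnZeroEquiv _ W x) y hy
    obtain ⟨t, rfl⟩ := (cohomologyOnZeroEquiv _ V).surjective t
    have res_eq : cohomologyOnRes _ 0 i x =
        t.comp (Ext.mk₀ I.shortComplex.g) (add_zero 0) := by
      apply (cohomologyOnZeroEquiv _ V).injective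
      rw [cohomologyOnZeroEquiv_cohomologyOnRes, cohomologyOnZeroEquiv_comp_mk₀]
      exact ht.symm
    refine ⟨V, i, hyV, ?_⟩
    rw [cohomologyOnRes_comp, res_eq, Ext.comp_assoc_of_second_deg_zero, hS.comp_extClass,
      Ext.comp_zero]
  | succ n ih =>
    let I : InjectivePresentation F := Classical.arbitrary _
    have : Injective I.shortComplex.X₂ := I.injective
    obtain ⟨x, rfl⟩ := ext_comp_extClass_surjective I.shortExact_shortComplex _ (n + 1) x
    obtain ⟨V, i, hyV, res_eq_zero⟩ := ih x
    exact ⟨V, i, hyV, by rw [cohomologyOnRes_comp, res_eq_zero, Ext.zero_comp]⟩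

/-- Surjectivity of the map `Hⁿ(U₁, F) ⊕ Hⁿ(U₂, F) → Hⁿ(U₁ ∩ U₂, F)` of the Mayer–Vietoris
sequence, written with a sum instead of a difference. -/
def MayerVietorisSurjective (F : SmallSheaf Y) (n : ℕ) (U₁ U₂ : Y.Opens) : Prop :=
  ∀ z : cohomologyOn F n (U₁ ⊓ U₂), ∃ (a : cohomologyOn F n U₁) (b : cohomologyOn F n U₂),
    cohomologyOnRes F n inf_le_left a + cohomologyOnRes F n inf_le_right b = z

lemma eq_zero_of_cohomologyOnRes_eq_zero {n : ℕ} {U₁ U₂ : Y.Opens} (hW : U₁ ⊔ U₂ = W)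
    (x : cohomologyOn F (n + 1) W)
    (hx₁ : cohomologyOnRes F (n + 1) (hW ▸ le_sup_left : U₁ ≤ W) x = 0)
    (hx₂ : cohomologyOnRes F (n + 1) (hW ▸ le_sup_right : U₂ ≤ W) x = 0)
    (hF : MayerVietorisSurjective F n U₁ U₂) : x = 0 := by
  subst hW
  let S := Opens.mayerVietorisSquare U₁ U₂
  have x_mem_ker : S.toBiprod F (n + 1) x = 0 :=
    (S.toBiprod_apply F x).trans ((congrArg _ (Prod.ext hx₁ hx₂)).trans (map_zero _))
  obtain ⟨z, rfl⟩ := (ShortComplex.ab_exact_iff _).1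
    ((S.sequence_exact F n (n + 1) rfl).exact 2) x x_mem_ker
  obtain ⟨a, b, rfl⟩ := hF z
  have z_mem_range : cohomologyOnRes F n inf_le_left a + cohomologyOnRes F n inf_le_right b =
      S.fromBiprod F n ((AddCommGrpCat.biprodIsoProd _ _).inv ⟨a, -b⟩) :=
    ((S.fromBiprod_biprodIsoProd_inv_apply F a (-b)).trans
      ((congrArg _ (map_neg _ _)).trans (sub_neg_eq_add _ _))).symm
  exact (congrArg (S.δ F n (n + 1) rfl) z_mem_range).trans
    (ConcreteCategory.congr_hom (S.fromBiprod_δ F n (n + 1) rfl) _)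

end CohomologyOfOpens

section AcyclicOpens

variable {Y Y' : Scheme.{u}} {F G : SmallSheaf Y}

/-- An open `V` is acyclic for `F` if the cohomology of `F` on `V` vanishes in positive degrees. -/
def IsAcyclicOn (F : SmallSheaf Y) (V : Y.Opens) : Prop :=
  ∀ n, Subsingleton (cohomologyOn F (n + 1) V)

lemma isAcyclicOn_of_injective [Injective F] (V : Y.Opens) : IsAcyclicOn F V :=
  fun _ => Ext.subsingleton_of_injective _ _ _

lemma IsAcyclicOn.of_shortExact {S : ShortComplex (SmallSheaf Y)} (hS : S.ShortExact)
    [Injective S.X₂] {V : Y.Opens} (hV : IsAcyclicOn S.X₁ V) : IsAcyclicOn S.X₃ V := by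
  refine fun n => subsingleton_of_forall_eq 0 fun x => ?_
  obtain ⟨z, rfl⟩ := Ext.covariant_sequence_exact₃ _ hS x rfl ((hV (n + 1)).elim _ _)
  rw [Ext.eq_zero_of_injective z, Ext.zero_comp]

lemma isBasis_mono {B B' : Set Y.Opens} (hB : Opens.IsBasis B) (h : B ⊆ B') : Opens.IsBasis B' :=
  Opens.isBasis_iff_nbhd.2 fun hy =>
    let ⟨V, hV, hyV, hVU⟩ := Opens.isBasis_iff_nbhd.1 hB hy
    ⟨V, h hV, hyV, hVU⟩

lemma epi_of_surjective_basis (g : F ⟶ G)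
    (hg : Opens.IsBasis {V | Function.Surjective (g.hom.app (op V))}) : Epi g := by
  refine (TopCat.Sheaf.isLocallySurjective_iff_epi (X := Y.toTopCat) g).1
    ((TopCat.Presheaf.isLocallySurjective_iff (X := Y.toTopCat) _).2 fun U t y hy => ?_)
  obtain ⟨V, surjective, hyV, hVU⟩ := Opens.isBasis_iff_nbhd.1 hg hy
  obtain ⟨s, hs⟩ := surjective (G.obj.map (homOfLE hVU).op t)
  exact ⟨V, hVU, ⟨s, hs⟩, hyV⟩

lemma isLocallyInjective_of_injective_basis (g : F ⟶ G)
    (hg : Opens.IsBasis {V | Function.Injective (g.hom.app (op V))}) :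
    Sheaf.IsLocallyInjective g where
  equalizerSieve_mem {U} s t hst y hy := by
    obtain ⟨V, injective, hyV, hVU⟩ := Opens.isBasis_iff_nbhd.1 hg hy
    refine ⟨V, homOfLE hVU, injective ?_, hyV⟩
    have naturality := g.hom.naturality (homOfLE hVU).op
    exact (ConcreteCategory.congr_hom naturality s).trans
      ((congrArg (G.obj.map (homOfLE hVU).op) hst).trans
        (ConcreteCategory.congr_hom naturality t).symm)

lemma isIso_of_bijective_basis (g : F ⟶ G)
    (hg : Opens.IsBasis {V | Function.Bijective (g.hom.app (op V))}) : IsIso g := by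
  have epi : Epi g := epi_of_surjective_basis g (isBasis_mono hg fun _ h => h.2)
  have injective := isLocallyInjective_of_injective_basis g (isBasis_mono hg fun _ h => h.1)
  have surjective := (Sheaf.isLocallySurjective_iff_epi' _ g).2 epi
  exact (Sheaf.isLocallyBijective_iff_isIso g).1 ⟨injective, surjective⟩

instance (h : Y' ⟶ Y) : (directImage h).Additive where

theorem cohomologyMap_bijective (h : Y' ⟶ Y) {G : SmallSheaf Y'} (α : (inverseImage h).obj F ⟶ G)
    [IsIso ((imageAdjunction h).homEquiv _ _ α)]
    (hG : Opens.IsBasis {V | IsAcyclicOn G (h ⁻¹ᵁ V)}) (q : ℕ) :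
    Function.Bijective (cohomologyMap h α q) := by
  let P (F : SmallSheaf Y') : Prop := Opens.IsBasis {V | IsAcyclicOn F (h ⁻¹ᵁ V)}
  have postcomp_bijective :
      Function.Bijective (Sheaf.H.map ((imageAdjunction h).homEquiv _ _ α) q) :=
    ((Sheaf.functorH (Opens.grothendieckTopology Y) q).mapIso
      (asIso ((imageAdjunction h).homEquiv _ _ α))).addCommGroupIsoToAddEquiv.bijective
  have adjunction_bijective := extAdjunctionMap_bijective.{u, u} (imageAdjunction h) P
    (fun I _ => Opens.isBasis_iff_nbhd.2 fun {U y} hy =>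
      ⟨U, isAcyclicOn_of_injective _, hy, le_rfl⟩)
    (fun S hS _ hS₁ => isBasis_mono hS₁ fun V hV => IsAcyclicOn.of_shortExact hS hV)
    (fun S hS _ hS₁ => epi_of_surjective_basis _ <| isBasis_mono hS₁ fun V hV =>
      app_surjective_of_subsingleton_cohomologyOn hS (hV 0)) (constZ Y) hG q
  have precomp_bijective : Function.Bijective ((Ext.mk₀ (constZMap h)).precomp G (zero_add q) :
      Ext.{u} ((inverseImage h).obj (constZ Y)) G q → Ext.{u} (constZ Y') G q) :=
    Function.bijective_iff_has_inverse.2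
      ⟨(Ext.mk₀ (inv (constZMap h))).precomp G (zero_add q), fun x => by simp, fun x => by simp⟩
  convert precomp_bijective.comp (adjunction_bijective.comp postcomp_bijective) using 1
  exact funext (cohomologyMap_eq_extAdjunctionMap h α q)

end AcyclicOpens

section Cech

variable {Y : Scheme.{u}} {F : SmallSheaf Y} {n : ℕ} {V : Y.Opens}

lemma cohomologyOnRes_basicOpen_add_eq_zero {x : cohomologyOn F (n + 1) V} {f g : Γ(Y, V)}
    (hF : ∀ f' g' : Γ(Y, Y.basicOpen (f + g)),
      Y.basicOpen f' ⊔ Y.basicOpen g' = Y.basicOpen (f + g) →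
        MayerVietorisSurjective F n (Y.basicOpen f') (Y.basicOpen g'))
    (hf : cohomologyOnRes F (n + 1) (Y.basicOpen_le f) x = 0)
    (hg : cohomologyOnRes F (n + 1) (Y.basicOpen_le g) x = 0) :
    cohomologyOnRes F (n + 1) (Y.basicOpen_le (f + g)) x = 0 := by
  let ρ := Y.presheaf.map (homOfLE (Y.basicOpen_le (f + g))).op
  have basicOpen_f : Y.basicOpen (ρ f) = Y.basicOpen (f + g) ⊓ Y.basicOpen f :=
    Scheme.basicOpen_res _ _ _
  have basicOpen_g : Y.basicOpen (ρ g) = Y.basicOpen (f + g) ⊓ Y.basicOpen g :=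
    Scheme.basicOpen_res _ _ _
  have cover : Y.basicOpen (ρ f) ⊔ Y.basicOpen (ρ g) = Y.basicOpen (f + g) := by
    rw [basicOpen_f, basicOpen_g, ← inf_sup_left]
    exact inf_eq_left.2 (Y.basicOpen_add_le f g)
  refine eq_zero_of_cohomologyOnRes_eq_zero cover _ ?_ ?_ (hF (ρ f) (ρ g) cover)
  · exact (cohomologyOnRes_cohomologyOnRes _ _ x).trans <| cohomologyOnRes_eq_zero_of_le
      (basicOpen_f.trans_le inf_le_right) (Y.basicOpen_le f) hf
  · exact (cohomologyOnRes_cohomologyOnRes _ _ x).trans <| cohomologyOnRes_eq_zero_of_le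
      (basicOpen_g.trans_le inf_le_right) (Y.basicOpen_le g) hg

lemma eq_zero_of_cohomologyOnRes_basicOpen_add (hV : IsAffineOpen V) {x : cohomologyOn F (n + 1) V}
    (add : ∀ f g : Γ(Y, V), cohomologyOnRes F (n + 1) (Y.basicOpen_le f) x = 0 →
      cohomologyOnRes F (n + 1) (Y.basicOpen_le g) x = 0 →
        cohomologyOnRes F (n + 1) (Y.basicOpen_le (f + g)) x = 0) : x = 0 := by
  let I : Ideal Γ(Y, V) :=
    { carrier := {f | cohomologyOnRes F (n + 1) (Y.basicOpen_le f) x = 0}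
      add_mem' := add _ _
      zero_mem' := by
        have : Subsingleton (cohomologyOn F (n + 1) (Y.basicOpen (0 : Γ(Y, V)))) := by
          rw [Scheme.basicOpen_zero]
          infer_instance
        exact Subsingleton.elim _ _
      smul_mem' r f hf := cohomologyOnRes_eq_zero_of_le
        ((Y.basicOpen_mul r f).trans_le inf_le_right) (Y.basicOpen_le f) hf }
  have span_eq_top : Ideal.span (I : Set Γ(Y, V)) = ⊤ := by
    rw [← hV.self_le_iSup_basicOpen_iff]
    intro y hy
    obtain ⟨W, hWV, hyW, res_eq_zero⟩ := exists_cohomologyOnRes_eq_zero x hy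
    obtain ⟨f, hfW, hyf⟩ := hV.exists_basicOpen_le ⟨y, hyW⟩ hy
    exact Opens.mem_iSup.2 ⟨⟨f, cohomologyOnRes_eq_zero_of_le hfW hWV res_eq_zero⟩, hyf⟩
  have one_mem : cohomologyOnRes F (n + 1) (Y.basicOpen_le 1) x = 0 :=
    (Ideal.eq_top_iff_one I).1 (I.span_eq ▸ span_eq_top)
  rw [← cohomologyOnRes_refl x]
  exact cohomologyOnRes_eq_zero_of_le (Scheme.basicOpen_of_isUnit _ isUnit_one).ge _ one_mem

/-- A class of affine opens which is closed under passing to basic opens. -/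
structure IsBasicOpenStable (𝓑 : Set Y.Opens) : Prop where
  isAffineOpen {V : Y.Opens} : V ∈ 𝓑 → IsAffineOpen V
  basicOpen_mem {V : Y.Opens} : V ∈ 𝓑 → ∀ f : Γ(Y, V), Y.basicOpen f ∈ 𝓑

/-- The Čech cohomology of `F` in degree one vanishes for all coverings of `V` by two basic
opens. -/
def HasCechDecomposition (F : SmallSheaf Y) (V : Y.Opens) : Prop :=
  ∀ f g : Γ(Y, V), Y.basicOpen f ⊔ Y.basicOpen g = V →
    ∀ z : F.obj.obj (op (Y.basicOpen f ⊓ Y.basicOpen g)),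
      ∃ (a : F.obj.obj (op (Y.basicOpen f))) (b : F.obj.obj (op (Y.basicOpen g))),
        F.obj.map (homOfLE inf_le_left).op a + F.obj.map (homOfLE inf_le_right).op b = z

lemma HasCechDecomposition.mayerVietorisSurjective (hF : HasCechDecomposition F V) {f g : Γ(Y, V)}
    (cover : Y.basicOpen f ⊔ Y.basicOpen g = V) :
    MayerVietorisSurjective F 0 (Y.basicOpen f) (Y.basicOpen g) := by
  intro z
  obtain ⟨a, b, hab⟩ := hF f g cover (cohomologyOnZeroEquiv F _ z)
  refine ⟨(cohomologyOnZeroEquiv F _).symm a, (cohomologyOnZeroEquiv F _).symm b,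
    (cohomologyOnZeroEquiv F _).injective ?_⟩
  rw [map_add, cohomologyOnZeroEquiv_cohomologyOnRes, cohomologyOnZeroEquiv_cohomologyOnRes,
    AddEquiv.apply_symm_apply, AddEquiv.apply_symm_apply, hab]

theorem isAcyclicOn_of_hasCechDecomposition {𝓑 : Set Y.Opens} (h𝓑 : IsBasicOpenStable 𝓑)
    (hF : ∀ V ∈ 𝓑, HasCechDecomposition F V) (hV : V ∈ 𝓑) : IsAcyclicOn F V := by
  intro n
  induction n using Nat.strong_induction_on generalizing V with
  | _ n ih =>
  have surjective : ∀ V ∈ 𝓑, ∀ f g : Γ(Y, V), Y.basicOpen f ⊔ Y.basicOpen g = V →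
      MayerVietorisSurjective F n (Y.basicOpen f) (Y.basicOpen g) := by
    intro V hV f g cover z
    cases n with
    | zero => exact (hF V hV).mayerVietorisSurjective cover z
    | succ m =>
      have : Subsingleton (cohomologyOn F (m + 1) (Y.basicOpen f ⊓ Y.basicOpen g)) := by
        rw [← Y.basicOpen_mul]
        exact ih m (Nat.lt_succ_self m) (h𝓑.basicOpen_mem hV (f * g))
      exact ⟨0, 0, Subsingleton.elim _ _⟩
  exact subsingleton_of_forall_eq 0 fun x =>
    eq_zero_of_cohomologyOnRes_basicOpen_add (h𝓑.isAffineOpen hV) fun f g =>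
      cohomologyOnRes_basicOpen_add_eq_zero (surjective _ (h𝓑.basicOpen_mem hV (f + g)))

end Cech

section PowerSeries

variable {σ B C : Type*} [CommRing B] [CommRing C]

/-- The ideal generated by the variables of a power series ring, which defines the topology in
`formalSpace`. -/
abbrev varsIdeal (σ B : Type*) [CommRing B] : Ideal (MvPowerSeries σ B) :=
  Ideal.span (Set.range MvPowerSeries.X)

lemma isNilpotent_span_range [Finite σ] {a : σ → C} (ha : ∀ i, IsNilpotent (a i)) :
    IsNilpotent (Ideal.span (Set.range a)) := by
  rw [Ideal.FG.isNilpotent_iff_le_nilradical (Submodule.fg_span (Set.finite_range a)),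
    Ideal.span_le]
  rintro _ ⟨i, rfl⟩
  exact ha i

lemma map_mem_span_range_pow {S F : Type*} [CommRing S] [FunLike F S C] [RingHomClass F S C]
    (Φ : F) (x : σ → S) {n : ℕ} {s : S} (hs : s ∈ Ideal.span (Set.range x) ^ n) :
    Φ s ∈ Ideal.span (Set.range (Φ ∘ x)) ^ n := by
  simpa only [Ideal.map_pow, Ideal.map_span, ← Set.range_comp] using Ideal.mem_map_of_mem Φ hs

variable [Finite σ]

lemma truncTotalAlgHom_coe (n : ℕ) (p : MvPolynomial σ B) :
    MvPowerSeries.truncTotalAlgHom σ B n (p : MvPowerSeries σ B) = Ideal.Quotient.mk _ p := by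
  simpa [MvPowerSeries.algebraMap_apply'] using
    (MvPowerSeries.truncTotalAlgHom σ B n).commutes p

lemma exists_powerSeries_hom (φ : B →+* C) (a : σ → C) (ha : ∀ i, IsNilpotent (a i)) :
    ∃ Φ : MvPowerSeries σ B →+* C, Φ.comp MvPowerSeries.C = φ ∧
      (∀ i, Φ (MvPowerSeries.X i) = a i) ∧ ∃ n, ∀ s ∈ varsIdeal σ B ^ n, Φ s = 0 := by
  obtain ⟨n, hn⟩ := isNilpotent_span_range ha
  have eval_eq_zero (p) (hp : p ∈ MvPolynomial.idealOfVars σ B ^ n) :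
      MvPolynomial.eval₂Hom φ a p = 0 := by
    have hX : MvPolynomial.eval₂Hom φ a ∘ MvPolynomial.X = a := by ext; simp
    simpa only [hX, hn, Ideal.zero_eq_bot, Ideal.mem_bot] using
      map_mem_span_range_pow (MvPolynomial.eval₂Hom φ a) _ hp
  let Φ : MvPowerSeries σ B →+* C := (Ideal.Quotient.lift _ _ eval_eq_zero).comp
    (MvPowerSeries.truncTotalAlgHom σ B n : MvPowerSeries σ B →+* _)
  have Φ_coe (p : MvPolynomial σ B) : Φ p = MvPolynomial.eval₂Hom φ a p :=
    (congrArg (Ideal.Quotient.lift _ _ eval_eq_zero) (truncTotalAlgHom_coe n p)).trans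
      (Ideal.Quotient.lift_mk _ _ _)
  have Φ_X (i : σ) : Φ (MvPowerSeries.X i) = a i := by
    rw [← MvPolynomial.coe_X, Φ_coe, MvPolynomial.coe_eval₂Hom, MvPolynomial.eval₂_X]
  refine ⟨Φ, RingHom.ext fun b => ?_, Φ_X, n, fun s hs => ?_⟩
  · rw [RingHom.comp_apply, ← MvPolynomial.coe_C, Φ_coe, MvPolynomial.coe_eval₂Hom,
      MvPolynomial.eval₂_C]
  · simpa [funext Φ_X, Function.comp_def, hn] using map_mem_span_range_pow Φ _ hs

lemma sub_truncTotal_mem_varsIdeal_pow (n : ℕ) (s : MvPowerSeries σ B) :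
    s - (MvPowerSeries.truncTotal n s : MvPolynomial σ B) ∈ varsIdeal σ B ^ n := by
  let I := MvPolynomial.idealOfVars σ B
  let t : MvPowerSeries σ B := s - (MvPowerSeries.truncTotal n s : MvPolynomial σ B)
  let completion := MvPowerSeries.toAdicCompletionAlgEquiv σ B
  have mem_ker : completion t ∈ (AdicCompletion.eval I (MvPolynomial σ B) n).ker := by
    rw [LinearMap.mem_ker, map_sub, map_sub, sub_eq_zero,
      MvPowerSeries.toAdicCompletionAlgEquiv_apply, MvPowerSeries.toAdicCompletionAlgEquiv_apply,
      MvPowerSeries.toAdicCompletion_coe]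
    rfl
  rw [← AdicCompletion.pow_smul_top_eq_ker_eval (MvPolynomial.idealOfVars_fg σ B)] at mem_ker
  have mem_map := Submodule.mem_map_of_mem (f := completion.symm.toLinearMap) mem_ker
  rw [Submodule.map_smul'', Submodule.map_top, LinearMap.range_eq_top.2
    completion.symm.surjective, Ideal.smul_top_eq_map] at mem_map
  change completion.symm (completion t) ∈ _ at mem_map
  rw [AlgEquiv.symm_apply_apply] at mem_map
  simpa [I, Ideal.map_pow, Ideal.map_span, ← Set.range_comp, Function.comp_def,
    MvPowerSeries.algebraMap_apply'] using mem_map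

lemma powerSeries_hom_ext {Φ Ψ : MvPowerSeries σ B →+* C}
    (hC : Φ.comp MvPowerSeries.C = Ψ.comp MvPowerSeries.C)
    (hX : ∀ i, Φ (MvPowerSeries.X i) = Ψ (MvPowerSeries.X i)) {n : ℕ}
    (hΦ : ∀ s ∈ varsIdeal σ B ^ n, Φ s = 0) (hΨ : ∀ s ∈ varsIdeal σ B ^ n, Ψ s = 0) : Φ = Ψ := by
  have hcoe : Φ.comp MvPolynomial.coeToMvPowerSeries.ringHom =
      Ψ.comp MvPolynomial.coeToMvPowerSeries.ringHom :=
    MvPolynomial.ringHom_ext (fun b => by simpa using DFunLike.congr_fun hC b)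
      fun i => by simpa using hX i
  ext s
  have mem := sub_truncTotal_mem_varsIdeal_pow n s
  calc Φ s = Φ (MvPowerSeries.truncTotal n s : MvPolynomial σ B) :=
        sub_eq_zero.1 ((map_sub Φ _ _).symm.trans (hΦ _ mem))
    _ = Ψ (MvPowerSeries.truncTotal n s : MvPolynomial σ B) := DFunLike.congr_fun hcoe _
    _ = Ψ s := (sub_eq_zero.1 ((map_sub Ψ _ _).symm.trans (hΨ _ mem))).symm

end PowerSeries

section TripleFibreProduct

variable {C : Type*} [CommRing C] (M : Ideal C)

/-- The fibre product `C ×_{C/M} C ×_{C/M} C`, the universal receptacle for two deformations along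
`M` of one and the same point. -/
abbrev tripleFibreProduct : Subring (C × C × C) :=
  RingHom.eqLocus ((Ideal.Quotient.mk M).comp (RingHom.fst C (C × C)))
      ((Ideal.Quotient.mk M).comp ((RingHom.fst C C).comp (RingHom.snd C (C × C)))) ⊓
    RingHom.eqLocus ((Ideal.Quotient.mk M).comp (RingHom.fst C (C × C)))
      ((Ideal.Quotient.mk M).comp ((RingHom.snd C C).comp (RingHom.snd C (C × C))))

namespace tripleFibreProduct

/-- The diagonal `c ↦ (c, c, c)`. -/
def diagonal : C →+* tripleFibreProduct M :=
  ((RingHom.id C).prod ((RingHom.id C).prod (RingHom.id C))).codRestrict _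
    fun _ => ⟨rfl, rfl⟩

/-- The projection to the base point `c` of `(c, c + m, c + n)`. -/
def base : tripleFibreProduct M →+* C :=
  (RingHom.fst _ _).comp (Subring.subtype _)

/-- The projection to the first deformation `c + m` of `(c, c + m, c + n)`. -/
def left : tripleFibreProduct M →+* C :=
  (RingHom.fst _ _).comp ((RingHom.snd _ _).comp (Subring.subtype _))

/-- The projection to the second deformation `c + n` of `(c, c + m, c + n)`. -/
def right : tripleFibreProduct M →+* C :=
  (RingHom.snd _ _).comp ((RingHom.snd _ _).comp (Subring.subtype _))

variable {M}

lemma left_sub_base_mem (p : tripleFibreProduct M) : left M p - base M p ∈ M :=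
  Ideal.Quotient.eq.1 p.2.1.symm

lemma right_sub_base_mem (p : tripleFibreProduct M) : right M p - base M p ∈ M :=
  Ideal.Quotient.eq.1 p.2.2.symm

/-- The point `(0, a, b)`. -/
def ofPair {a b : C} (ha : a ∈ M) (hb : b ∈ M) : tripleFibreProduct M :=
  ⟨(0, a, b), (Ideal.Quotient.eq.2 (by simpa using ha)).symm,
    (Ideal.Quotient.eq.2 (by simpa using hb)).symm⟩

lemma isNilpotent_ofPair (hM : ∀ a ∈ M, ∀ b ∈ M, a * b = 0) {a b : C} (ha : a ∈ M) (hb : b ∈ M) :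
    IsNilpotent (ofPair ha hb) :=
  ⟨2, (sq _).trans <| Subtype.ext <|
    Prod.ext (zero_mul _) (Prod.ext (hM _ ha _ ha) (hM _ hb _ hb))⟩

/-- The ring homomorphism `(c, c + m, c + n) ↦ c + m + n` for an ideal `M` of square zero. -/
def sum (hM : ∀ a ∈ M, ∀ b ∈ M, a * b = 0) : tripleFibreProduct M →+* C where
  toFun p := left M p + right M p - base M p
  map_zero' := by simp only [map_zero, add_zero, sub_zero]
  map_one' := by simp only [map_one, add_sub_cancel_right]
  map_add' p q := by simp only [map_add]; ring
  map_mul' p q := by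
    simp only [map_mul]
    linear_combination -hM _ (left_sub_base_mem p) _ (right_sub_base_mem q) -
      hM _ (right_sub_base_mem p) _ (left_sub_base_mem q)

lemma sum_ofPair (hM : ∀ a ∈ M, ∀ b ∈ M, a * b = 0) {a b : C} (ha : a ∈ M) (hb : b ∈ M) :
    sum hM (ofPair ha hb) = a + b :=
  sub_zero _

end tripleFibreProduct

end TripleFibreProduct

section FormalCoordinates

variable {V : Scheme.{u}} {d : ℕ} {P : (Over V)ᵒᵖ ⥤ AddCommGrpCat.{u}}
  (e : P ⋙ forget AddCommGrpCat.{u} ≅ formalSpace V d)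

/-- The coordinates of a point of a functor identified with a formal affine space. -/
def formalCoord {Z : Over V} (x : P.obj (op Z)) (i : Fin d) : Γ(Z.left, ⊤) :=
  (e.hom.app (op Z) x).1 (MvPowerSeries.X i)

lemma formalCoord_map {Z Z' : Over V} (h : Z' ⟶ Z) (x : P.obj (op Z)) (i : Fin d) :
    formalCoord e (P.map h.op x) i = h.left.appTop (formalCoord e x i) :=
  congrArg (fun t => t.1 (MvPowerSeries.X i))
    (ConcreteCategory.congr_hom (e.hom.naturality h.op) x)

lemma formalSpace_exists_pow_eq_zero {Z : Over V} [CompactSpace Z.left]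
    (φ : (formalSpace V d).obj (op Z)) :
    ∃ n : ℕ, ∀ s ∈ varsIdeal (Fin d) Γ(V, ⊤) ^ n, φ.1 s = 0 := by
  choose W hW n hn using φ.2.2
  obtain ⟨t, ht⟩ := isCompact_univ.elim_finite_subcover (fun z => (W z : Set Z.left))
    (fun z => (W z).2) (fun z _ => Set.mem_iUnion.2 ⟨z, hW z⟩)
  refine ⟨t.sup n, fun s hs => TopCat.Sheaf.eq_of_locally_eq' Z.left.sheaf (fun z : t => W z) ⊤
    (fun z => homOfLE le_top) (fun y _ => ?_) _ _ fun z => ?_⟩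
  · obtain ⟨z, hz, hy⟩ := Set.mem_iUnion₂.1 (ht (Set.mem_univ y))
    exact Opens.mem_iSup.2 ⟨⟨z, hz⟩, hy⟩
  · exact (hn z s (Ideal.pow_le_pow_right (Finset.le_sup z.2) hs)).trans (map_zero _).symm

lemma formalCoord_ext {Z : Over V} [CompactSpace Z.left] {x y : P.obj (op Z)}
    (h : ∀ i, formalCoord e x i = formalCoord e y i) : x = y := by
  obtain ⟨n, hn⟩ := formalSpace_exists_pow_eq_zero (e.hom.app (op Z) x)
  obtain ⟨m, hm⟩ := formalSpace_exists_pow_eq_zero (e.hom.app (op Z) y)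
  exact (ConcreteCategory.bijective_of_isIso (e.hom.app (op Z))).1 <| Subtype.ext <|
    powerSeries_hom_ext (n := max n m)
      ((e.hom.app (op Z) x).2.1.trans (e.hom.app (op Z) y).2.1.symm) h
      (fun s hs => hn s (Ideal.pow_le_pow_right (le_max_left _ _) hs))
      (fun s hs => hm s (Ideal.pow_le_pow_right (le_max_right _ _) hs))

lemma exists_formalCoord_eq (Z : Over V) (a : Fin d → Γ(Z.left, ⊤))
    (ha : ∀ i, IsNilpotent (a i)) : ∃ x : P.obj (op Z), ∀ i, formalCoord e x i = a i := by
  obtain ⟨Φ, hC, hX, n, hn⟩ := exists_powerSeries_hom Z.hom.appTop.hom a ha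
  let φ : (formalSpace V d).obj (op Z) :=
    ⟨Φ, hC, fun z => ⟨⊤, trivial, n, fun s hs => by rw [hn s hs, map_zero]⟩⟩
  exact ⟨e.inv.app (op Z) φ, fun i => (congrArg (fun t => t.1 (MvPowerSeries.X i))
    (ConcreteCategory.congr_hom (e.inv_hom_id_app (op Z)) φ)).trans (hX i)⟩

section Affine

variable {Z : Over V} [IsAffine Z.left] {D : CommRingCat.{u}} (ψ : Γ(Z.left, ⊤) ⟶ D)

/-- For an affine `V`-scheme `Z` and a `Γ(Z)`-algebra `D`, the `V`-scheme `Spec D`. -/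
def specOver : Over V :=
  Over.mk (Spec.map ψ ≫ Z.left.isoSpec.inv ≫ Z.hom)

instance : IsAffine (specOver ψ).left :=
  inferInstanceAs (IsAffine (Spec D))

/-- The `V`-morphism `Spec D ⟶ Z`. -/
def specOverToBase : specOver ψ ⟶ Z :=
  Over.homMk (Spec.map ψ ≫ Z.left.isoSpec.inv) (Category.assoc _ _ _)

variable {ψ} in
/-- The section `Z ⟶ Spec D` given by a retraction `D ⟶ Γ(Z)`. -/
def specOverSection {χ : D ⟶ Γ(Z.left, ⊤)} (h : ψ ≫ χ = 𝟙 _) : Z ⟶ specOver ψ :=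
  Over.homMk (Z.left.isoSpec.hom ≫ Spec.map χ) (by
    dsimp only [specOver, Over.mk_hom]
    rw [Category.assoc, ← Spec.map_comp_assoc, h, Spec.map_id, Category.id_comp,
      Iso.hom_inv_id_assoc])

/-- The identification `Γ(Spec D) ≅ D`. -/
def specOverΓIso : Γ((specOver ψ).left, ⊤) ≅ D :=
  Scheme.ΓSpecIso D

lemma specOverToBase_appTop_comp :
    (specOverToBase ψ).left.appTop ≫ (specOverΓIso ψ).hom = ψ := by
  change (Spec.map ψ ≫ Z.left.isoSpec.inv).appTop ≫ (Scheme.ΓSpecIso D).hom = _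
  rw [Scheme.Hom.comp_appTop, Category.assoc, Scheme.ΓSpecIso_naturality,
    ← Scheme.toSpecΓ_appTop, ← Scheme.isoSpec_hom, ← Scheme.Hom.comp_appTop_assoc,
    Iso.hom_inv_id, Scheme.Hom.id_appTop, Category.id_comp]

lemma specOverToBase_appTop_eq_zero_iff (a : Γ(Z.left, ⊤)) :
    (specOverToBase ψ).left.appTop a = 0 ↔ ψ a = 0 := by
  rw [← ConcreteCategory.congr_hom (specOverToBase_appTop_comp ψ) a, CommRingCat.comp_apply]
  exact (map_eq_zero_iff (specOverΓIso ψ).hom.hom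
    (ConcreteCategory.bijective_of_isIso (specOverΓIso ψ).hom).1).symm

lemma specOverSection_appTop {χ : D ⟶ Γ(Z.left, ⊤)} (h : ψ ≫ χ = 𝟙 _) :
    (specOverSection h).left.appTop = (specOverΓIso ψ).hom ≫ χ := by
  change (Z.left.isoSpec.hom ≫ Spec.map χ).appTop = _
  rw [Scheme.Hom.comp_appTop, Scheme.isoSpec_hom, Scheme.toSpecΓ_appTop,
    Scheme.ΓSpecIso_naturality]
  rfl

lemma formalCoord_map_specOverSection {χ : D ⟶ Γ(Z.left, ⊤)} (h : ψ ≫ χ = 𝟙 _)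
    (ξ : P.obj (op (specOver ψ))) (i : Fin d) :
    formalCoord e (P.map (specOverSection h).op ξ) i =
      χ ((specOverΓIso ψ).hom (formalCoord e ξ i)) := by
  rw [formalCoord_map, specOverSection_appTop, CommRingCat.comp_apply]

lemma exists_map_specOverSection_eq (a : Fin d → D) (ha : ∀ i, IsNilpotent (a i)) :
    ∃ ξ : P.obj (op (specOver ψ)), ∀ (χ : D ⟶ Γ(Z.left, ⊤)) (h : ψ ≫ χ = 𝟙 _)
      (w : P.obj (op Z)), (∀ i, formalCoord e w i = χ (a i)) →
        P.map (specOverSection h).op ξ = w := by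
  obtain ⟨ξ, hξ⟩ := exists_formalCoord_eq e (specOver ψ)
    (fun i => (specOverΓIso ψ).inv (a i)) (fun i => (ha i).map _)
  refine ⟨ξ, fun χ h w hw => formalCoord_ext e fun i => ?_⟩
  rw [formalCoord_map_specOverSection, hξ, hw]
  exact congrArg χ (ConcreteCategory.congr_hom (specOverΓIso ψ).inv_hom_id _)

end Affine

variable {e} (h0 : ∀ i, formalCoord e (0 : P.obj (op (Over.mk (𝟙 V)))) i = 0)
include h0

lemma formalCoord_zero (Z : Over V) (i : Fin d) : formalCoord e (0 : P.obj (op Z)) i = 0 := by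
  have := formalCoord_map e (Over.mkIdTerminal.from Z) 0 i
  rwa [map_zero, h0, map_zero] at this

-- The points `x` and `y` are the two deformations of `0` in one point `α + β` over the triple fibre
-- product of `Γ(Z)`, which `tripleFibreProduct.sum` maps to `x + y`.
open tripleFibreProduct in
lemma formalCoord_add_of_mul_eq_zero {Z : Over V} [IsAffine Z.left] {M : Ideal Γ(Z.left, ⊤)}
    (hM : ∀ a ∈ M, ∀ b ∈ M, a * b = 0) {x y : P.obj (op Z)} (hx : ∀ i, formalCoord e x i ∈ M)
    (hy : ∀ i, formalCoord e y i ∈ M) (i : Fin d) :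
    formalCoord e (x + y) i = formalCoord e x i + formalCoord e y i := by
  let D : CommRingCat.{u} := CommRingCat.of (tripleFibreProduct M)
  let ψ : Γ(Z.left, ⊤) ⟶ D := CommRingCat.ofHom (diagonal M)
  let b : D ⟶ Γ(Z.left, ⊤) := CommRingCat.ofHom (base M)
  let l : D ⟶ Γ(Z.left, ⊤) := CommRingCat.ofHom (left M)
  let r : D ⟶ Γ(Z.left, ⊤) := CommRingCat.ofHom (right M)
  let s : D ⟶ Γ(Z.left, ⊤) := CommRingCat.ofHom (sum hM)
  have hs : ψ ≫ s = 𝟙 _ := by ext c; exact add_sub_cancel_right c c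
  obtain ⟨α, hα⟩ := exists_map_specOverSection_eq e ψ (fun i => ofPair (hx i) M.zero_mem)
    fun i => isNilpotent_ofPair hM _ _
  obtain ⟨β, hβ⟩ := exists_map_specOverSection_eq e ψ (fun i => ofPair M.zero_mem (hy i))
    fun i => isNilpotent_ofPair hM _ _
  have zero := formalCoord_zero h0 Z
  have map_base : P.map (specOverSection (rfl : ψ ≫ b = 𝟙 _)).op (α + β) = 0 := by
    rw [map_add, hα b rfl 0 zero, hβ b rfl 0 zero, add_zero]
  have map_left : P.map (specOverSection (rfl : ψ ≫ l = 𝟙 _)).op (α + β) = x := by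
    rw [map_add, hα l rfl x fun _ => rfl, hβ l rfl 0 zero, add_zero]
  have map_right : P.map (specOverSection (rfl : ψ ≫ r = 𝟙 _)).op (α + β) = y := by
    rw [map_add, hα r rfl 0 zero, hβ r rfl y fun _ => rfl, zero_add]
  have map_sum : P.map (specOverSection hs).op (α + β) = x + y := by
    rw [map_add, hα s hs x fun i => ?_, hβ s hs y fun i => ?_]
    · exact ((sum_ofPair hM _ _).trans (zero_add _)).symm
    · exact ((sum_ofPair hM _ _).trans (add_zero _)).symm
  let c : D := (specOverΓIso ψ).hom (formalCoord e (α + β) i)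
  calc formalCoord e (x + y) i = l c + r c - b c := by
        rw [← map_sum, formalCoord_map_specOverSection]; rfl
    _ = formalCoord e x i + formalCoord e y i - 0 := by
        rw [← formalCoord_map_specOverSection e ψ rfl, map_left,
          ← formalCoord_map_specOverSection e ψ rfl, map_right,
          ← formalCoord_map_specOverSection e ψ rfl, map_base, zero]
    _ = _ := sub_zero _

lemma formalCoord_map_add {Z Z' : Over V} [IsAffine Z'.left] (ι : Z' ⟶ Z) {I : Ideal Γ(Z.left, ⊤)}
    (hI : I * I ≤ RingHom.ker ι.left.appTop.hom) {x y : P.obj (op Z)}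
    (hx : ∀ i, formalCoord e x i ∈ I) (hy : ∀ i, formalCoord e y i ∈ I) (i : Fin d) :
    formalCoord e (P.map ι.op (x + y)) i =
      ι.left.appTop (formalCoord e x i + formalCoord e y i) := by
  let M : Ideal Γ(Z'.left, ⊤) := I.map ι.left.appTop.hom
  have hM : M * M = ⊥ := by
    rw [← Ideal.map_mul, eq_bot_iff, Ideal.map_le_iff_le_comap]
    exact hI
  have mul_eq_zero (a) (ha : a ∈ M) (b) (hb : b ∈ M) : a * b = 0 := by
    simpa only [hM, Ideal.mem_bot] using Ideal.mul_mem_mul ha hb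
  have coord_mem {w : P.obj (op Z)} (hw : ∀ i, formalCoord e w i ∈ I) (i : Fin d) :
      formalCoord e (P.map ι.op w) i ∈ M := by
    rw [formalCoord_map]
    exact Ideal.mem_map_of_mem ι.left.appTop.hom (hw i)
  rw [map_add, formalCoord_add_of_mul_eq_zero h0 mul_eq_zero (coord_mem hx) (coord_mem hy),
    formalCoord_map, formalCoord_map, map_add]

lemma formalCoord_sub_add_mem {Z : Over V} [IsAffine Z.left] {I J : Ideal Γ(Z.left, ⊤)}
    (hIJ : I * I ≤ J) {x y z : P.obj (op Z)} (hx : ∀ i, formalCoord e x i ∈ I)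
    (hy : ∀ i, formalCoord e y i ∈ I)
    (hz : ∀ i, formalCoord e z i - (formalCoord e x i + formalCoord e y i) ∈ J) (i : Fin d) :
    formalCoord e (z - (x + y)) i ∈ J := by
  obtain ⟨Z', _, ι, hι⟩ : ∃ (Z' : Over V) (_ : IsAffine Z'.left) (ι : Z' ⟶ Z),
      RingHom.ker ι.left.appTop.hom = J :=
    ⟨specOver (CommRingCat.ofHom (Ideal.Quotient.mk J)), inferInstance, specOverToBase _,
      Ideal.ext fun a => (specOverToBase_appTop_eq_zero_iff _ a).trans
        Ideal.Quotient.eq_zero_iff_mem⟩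
  rw [← hι] at hIJ hz ⊢
  have map_eq : P.map ι.op z = P.map ι.op (x + y) := by
    refine formalCoord_ext e fun i => ?_
    rw [formalCoord_map_add h0 ι hIJ hx hy, formalCoord_map]
    exact (RingHom.sub_mem_ker_iff _).1 (hz i)
  rw [RingHom.mem_ker]
  exact (formalCoord_map e ι _ i).symm.trans
    (by rw [map_sub, map_eq, sub_self, formalCoord_zero h0])

end FormalCoordinates

section ChartCoordinates

variable {X : Scheme.{u}} {E : BigSheaf X} {U : X.Opens}

variable (E U) in
/-- Coordinates on a sheaf of groups `E` over the open `U`: over `X`-schemes lying over `U`, tuples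
of nilpotent functions are coordinates of unique points of `E`, naturally, and the group law is
additive up to products of coordinates. -/
structure ChartCoordinates where
  /-- The number of coordinates. -/
  dim : ℕ
  /-- The coordinates of a point. -/
  coord {Z : Over X} (hZ : Set.range Z.hom ⊆ U) (x : E.obj.obj (op Z)) (i : Fin dim) : Γ(Z.left, ⊤)
  coord_map {Z Z' : Over X} (hZ : Set.range Z.hom ⊆ U) (hZ' : Set.range Z'.hom ⊆ U) (h : Z' ⟶ Z)
    (x : E.obj.obj (op Z)) (i : Fin dim) :
      coord hZ' (E.obj.map h.op x) i = h.left.appTop (coord hZ x i)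
  coord_zero {Z : Over X} (hZ : Set.range Z.hom ⊆ U) (i : Fin dim) :
    coord hZ (0 : E.obj.obj (op Z)) i = 0
  eq_of_coord_eq {Z : Over X} [CompactSpace Z.left] (hZ : Set.range Z.hom ⊆ U)
    {x y : E.obj.obj (op Z)} (h : ∀ i, coord hZ x i = coord hZ y i) : x = y
  exists_coord_eq {Z : Over X} (hZ : Set.range Z.hom ⊆ U) (a : Fin dim → Γ(Z.left, ⊤))
    (ha : ∀ i, IsNilpotent (a i)) : ∃ x : E.obj.obj (op Z), ∀ i, coord hZ x i = a i
  coord_sub_add_mem {Z : Over X} [IsAffine Z.left] (hZ : Set.range Z.hom ⊆ U)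
    {I J : Ideal Γ(Z.left, ⊤)} (hIJ : I * I ≤ J) {x y z : E.obj.obj (op Z)}
    (hx : ∀ i, coord hZ x i ∈ I) (hy : ∀ i, coord hZ y i ∈ I)
    (hz : ∀ i, coord hZ z i - (coord hZ x i + coord hZ y i) ∈ J) (i : Fin dim) :
    coord hZ (z - (x + y)) i ∈ J

/-- An `X`-scheme lying over `U`, as a `U`-scheme. -/
def liftOver (Z : Over X) (hZ : Set.range Z.hom ⊆ U) : Over (U : Scheme.{u}) :=
  Over.mk (IsOpenImmersion.lift U.ι Z.hom (by rwa [Scheme.Opens.range_ι]))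

/-- `liftOver` does not change the underlying `X`-scheme. -/
def liftOverIso (Z : Over X) (hZ : Set.range Z.hom ⊆ U) :
    (Over.map U.ι).obj (liftOver Z hZ) ≅ Z :=
  Over.isoMk (Iso.refl _) ((Category.id_comp _).trans (IsOpenImmersion.lift_fac _ _ _).symm)

variable {Z Z' : Over X} (hZ : Set.range Z.hom ⊆ U) (hZ' : Set.range Z'.hom ⊆ U) (h : Z' ⟶ Z)

/-- Functoriality of `liftOver`. -/
def liftOverMap : liftOver Z' hZ' ⟶ liftOver Z hZ :=
  Over.homMk h.left (by
    rw [← cancel_mono U.ι]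
    simp [liftOver, IsOpenImmersion.lift_fac])

lemma map_liftOverMap_comp_liftOverIso_hom :
    (Over.map U.ι).map (liftOverMap hZ hZ' h) ≫ (liftOverIso Z hZ).hom =
      (liftOverIso Z' hZ').hom ≫ h := by
  ext1
  exact (Category.comp_id _).trans (Category.id_comp _).symm

variable (E) in
/-- The points of `E` over an `X`-scheme lying over `U` are the points over the `U`-scheme. -/
def pointsLiftIso : E.obj.obj (op Z) ≅ ((Over.map U.ι).op ⋙ E.obj).obj (op (liftOver Z hZ)) :=
  E.obj.mapIso (liftOverIso Z hZ).op

lemma pointsLiftIso_hom_map (x : E.obj.obj (op Z)) :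
    (pointsLiftIso E hZ').hom (E.obj.map h.op x) =
      ((Over.map U.ι).op ⋙ E.obj).map (liftOverMap hZ hZ' h).op ((pointsLiftIso E hZ).hom x) := by
  change (E.obj.map h.op ≫ E.obj.map (liftOverIso Z' hZ').hom.op) x =
    (E.obj.map (liftOverIso Z hZ).hom.op ≫
      E.obj.map ((Over.map U.ι).map (liftOverMap hZ hZ' h)).op) x
  rw [← E.obj.map_comp, ← E.obj.map_comp, ← op_comp, ← op_comp,
    map_liftOverMap_comp_liftOverIso_hom]

/-- The coordinates given by an isomorphism with a formal affine space. -/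
def ChartCoordinates.ofIso {d : ℕ}
    (e : ((Over.map U.ι).op ⋙ E.obj) ⋙ forget AddCommGrpCat.{u} ≅ formalSpace U d)
    (h0 : ∀ i, formalCoord e (Z := Over.mk (𝟙 (U : Scheme.{u}))) 0 i = 0) :
    ChartCoordinates E U where
  dim := d
  coord hZ x := formalCoord e ((pointsLiftIso E hZ).hom x)
  coord_map hZ hZ' h x i := by
    rw [pointsLiftIso_hom_map hZ hZ']
    exact formalCoord_map e (liftOverMap hZ hZ' h) _ i
  coord_zero hZ i := by
    rw [map_zero]
    exact formalCoord_zero h0 _ i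
  eq_of_coord_eq {Z} _ hZ x y h :=
    have : CompactSpace (liftOver Z hZ).left := inferInstanceAs (CompactSpace Z.left)
    (ConcreteCategory.bijective_of_isIso (pointsLiftIso E hZ).hom).1 (formalCoord_ext e h)
  exists_coord_eq hZ a ha := by
    obtain ⟨x, hx⟩ := exists_formalCoord_eq e (liftOver _ hZ) a ha
    obtain ⟨y, rfl⟩ := (ConcreteCategory.bijective_of_isIso (pointsLiftIso E hZ).hom).2 x
    exact ⟨y, hx⟩
  coord_sub_add_mem {Z} _ hZ I J hIJ x y z hx hy hz i := by
    have : IsAffine (liftOver Z hZ).left := inferInstanceAs (IsAffine Z.left)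
    rw [map_sub, map_add]
    exact formalCoord_sub_add_mem (Z := liftOver Z hZ) h0 hIJ hx hy hz i

lemma IsFormalLieGroup.exists_chartCoordinates (hE : IsFormalLieGroup E) (x : X) :
    ∃ U : X.Opens, x ∈ U ∧ Nonempty (ChartCoordinates E U) := by
  obtain ⟨U, hx, -, d, e, h0⟩ := hE x
  exact ⟨U, hx, ⟨.ofIso e h0⟩⟩

end ChartCoordinates

section Rings

open TensorProduct

lemma ker_eq_map_of_isPushout {A : Type u} [CommRing A] {C C' : CommRingCat.{u}}
    {a : CommRingCat.of A ⟶ C} {I : Ideal A} {c : C ⟶ C'} {b : CommRingCat.of (A ⧸ I) ⟶ C'}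
    (h : IsPushout a (CommRingCat.ofHom (Ideal.Quotient.mk I)) c b) :
    RingHom.ker c.hom = I.map a.hom := by
  refine le_antisymm (fun x hx => ?_) (Ideal.map_le_iff_le_comap.2 fun y hy => ?_)
  · let b' : CommRingCat.of (A ⧸ I) ⟶ CommRingCat.of (C ⧸ I.map a.hom) :=
      CommRingCat.ofHom (Ideal.quotientMap _ a.hom Ideal.le_comap_map)
    have hfac := ConcreteCategory.congr_hom
      (h.inl_desc (CommRingCat.ofHom (Ideal.Quotient.mk (I.map a.hom))) b' rfl) x
    rw [CommRingCat.comp_apply, RingHom.mem_ker.1 hx, map_zero] at hfac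
    exact Ideal.Quotient.eq_zero_iff_mem.1 hfac.symm
  · refine (ConcreteCategory.congr_hom h.w y).trans ((congrArg b ?_).trans (map_zero b.hom))
    exact Ideal.Quotient.eq_zero_iff_mem.2 hy

section Flat

variable {N A C : Type*} [CommRing N] [CommRing A] [CommRing C] [Algebra N A] [Algebra N C]
  {I : Ideal N} {J : Ideal A}

-- By flatness, `I C` and `J (A ⊗ C)` are both isomorphic to `I ⊗ C`.
lemma bijOn_includeRight_of_flat [Module.Flat N C] (h : Set.BijOn (algebraMap N A) I J) :
    Set.BijOn (Algebra.TensorProduct.includeRight : C →ₐ[N] A ⊗[N] C) (I.map (algebraMap N C))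
      (J.map (Algebra.TensorProduct.includeLeft : A →ₐ[N] A ⊗[N] C)) := by
  let e : I →ₗ[N] J.restrictScalars N := (Algebra.linearMap N A).restrict h.mapsTo
  let u : I ⊗[N] C →ₗ[N] C := (TensorProduct.lid N C).toLinearMap ∘ₗ I.subtype.rTensor C
  let v : I ⊗[N] C →ₗ[N] A ⊗[N] C := ((J.restrictScalars N).subtype ∘ₗ e).rTensor C
  have hu (x : C) : x ∈ I.map (algebraMap N C) ↔ ∃ t, u t = x := by
    rw [← LinearMap.mem_range, Ideal.subtype_rTensor_range, Ideal.smul_top_eq_map,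
      Submodule.restrictScalars_mem]
  have hv (y : A ⊗[N] C) :
      y ∈ J.map (Algebra.TensorProduct.includeLeft : A →ₐ[N] A ⊗[N] C) ↔ ∃ t, v t = y := by
    have he : Function.Surjective e := fun j =>
      let ⟨n, hn, hnj⟩ := h.surjOn j.2
      ⟨⟨n, hn⟩, Subtype.ext hnj⟩
    rw [← Submodule.restrictScalars_mem N, Ideal.map_includeLeft_eq, ← LinearMap.mem_range,
      show v = _ from LinearMap.rTensor_comp _ _ _, LinearMap.range_comp_of_range_eq_top _
        (LinearMap.range_eq_top.2 (LinearMap.rTensor_surjective C he))]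
  have hv_inj : Function.Injective v := Module.Flat.rTensor_preserves_injective_linearMap _
    fun m n hmn => Subtype.ext (h.injOn m.2 n.2 hmn)
  have huv (t : I ⊗[N] C) : Algebra.TensorProduct.includeRight (u t) = v t := by
    refine LinearMap.congr_fun (f := Algebra.TensorProduct.includeRight.toLinearMap ∘ₗ u)
      (TensorProduct.ext' fun n c => ?_) t
    change (1 : A) ⊗ₜ[N] (n.1 • c) = algebraMap N A n ⊗ₜ[N] c
    rw [TensorProduct.tmul_smul, TensorProduct.smul_tmul', Algebra.algebraMap_eq_smul_one]
  refine ⟨fun x hx => ?_, fun x hx x' hx' hxx' => ?_, fun y hy => ?_⟩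
  · obtain ⟨t, rfl⟩ := (hu x).1 hx
    exact (hv _).2 ⟨t, (huv t).symm⟩
  · obtain ⟨t, rfl⟩ := (hu x).1 hx
    obtain ⟨t', rfl⟩ := (hu x').1 hx'
    rw [huv, huv] at hxx'
    rw [hv_inj hxx']
  · obtain ⟨t, rfl⟩ := (hv y).1 hy
    exact ⟨u t, (hu _).2 ⟨t, rfl⟩, huv t⟩

end Flat

lemma bijOn_map_of_isPushout {N A : Type u} [CommRing N] [CommRing A] {C C' : CommRingCat.{u}}
    {a : CommRingCat.of N ⟶ C} {θ : N →+* A} {c : C ⟶ C'} {b : CommRingCat.of A ⟶ C'}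
    (h : IsPushout a (CommRingCat.ofHom θ) c b) (ha : a.hom.Flat) {I : Ideal N} {J : Ideal A}
    (hIJ : Set.BijOn θ I J) : Set.BijOn c (I.map a.hom) (J.map b.hom) := by
  algebraize [a.hom, θ]
  let i := (CommRingCat.isPushout_tensorProduct N A C).isoIsPushout _ _ h.flip
  have hc : c = CommRingCat.ofHom (Algebra.TensorProduct.includeRight : C →ₐ[N] A ⊗[N] C).toRingHom
      ≫ i.hom := (IsPushout.inr_isoIsPushout_hom ..).symm
  have hb : b = CommRingCat.ofHom (Algebra.TensorProduct.includeLeft : A →ₐ[N] A ⊗[N] C).toRingHom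
      ≫ i.hom := (IsPushout.inl_isoIsPushout_hom ..).symm
  have hi : Function.Bijective i.hom.hom := ConcreteCategory.bijective_of_isIso i.hom
  have himage : i.hom '' (J.map (Algebra.TensorProduct.includeLeft : A →ₐ[N] A ⊗[N] C)) =
      J.map b.hom := by
    rw [hb, CommRingCat.hom_comp, ← Ideal.map_map]
    exact Set.ext fun y => (Ideal.mem_map_iff_of_surjective i.hom.hom hi.2).symm
  rw [hc, ← himage]
  exact hi.1.injOn.bijOn_image.comp (bijOn_includeRight_of_flat hIJ)

end Rings

section Localization

lemma exists_add_of_isLocalization {C Cf Cg Cfg : Type*} [CommRing C] [CommRing Cf] [CommRing Cg]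
    [CommRing Cfg] [Algebra C Cf] [Algebra C Cg] [Algebra C Cfg] [Algebra Cf Cfg] [Algebra Cg Cfg]
    [IsScalarTower C Cf Cfg] [IsScalarTower C Cg Cfg] {f g : C} (hfg : Ideal.span {f, g} = ⊤)
    [IsLocalization.Away f Cf] [IsLocalization.Away g Cg] [IsLocalization.Away (f * g) Cfg]
    (K : Ideal C) {z : Cfg} (hz : z ∈ K.map (algebraMap C Cfg)) :
    ∃ x ∈ K.map (algebraMap C Cf), ∃ y ∈ K.map (algebraMap C Cg),
      algebraMap Cf Cfg x + algebraMap Cg Cfg y = z := by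
  obtain ⟨⟨⟨k, hk⟩, ⟨_, n, rfl⟩⟩, hkz⟩ :=
    (IsLocalization.mem_map_algebraMap_iff (Submonoid.powers (f * g)) Cfg).1 hz
  have hpow : Ideal.span {f ^ n, g ^ n} = ⊤ := by
    simpa only [Set.image_pair] using Ideal.span_pow_eq_top {f, g} hfg n
  obtain ⟨r, s, hrs⟩ := Ideal.mem_span_pair.1 ((Ideal.eq_top_iff_one _).1 hpow)
  let u : Submonoid.powers f := ⟨f ^ n, n, rfl⟩
  let v : Submonoid.powers g := ⟨g ^ n, n, rfl⟩
  refine ⟨IsLocalization.mk' Cf (s * k) u, ?_, IsLocalization.mk' Cg (r * k) v, ?_, ?_⟩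
  · exact (IsLocalization.mk'_mem_map_algebraMap_iff (Submonoid.powers f) Cf K _ u).2
      ⟨1, one_mem _, by simpa using K.mul_mem_left s hk⟩
  · exact (IsLocalization.mk'_mem_map_algebraMap_iff (Submonoid.powers g) Cg K _ v).2
      ⟨1, one_mem _, by simpa using K.mul_mem_left r hk⟩
  · have hx := congrArg (algebraMap Cf Cfg) (IsLocalization.mk'_spec Cf (s * k) u)
    have hy := congrArg (algebraMap Cg Cfg) (IsLocalization.mk'_spec Cg (r * k) v)
    have hone := congrArg (algebraMap C Cfg) hrs
    have hunit : IsUnit (algebraMap C Cfg f ^ n * algebraMap C Cfg g ^ n) := by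
      rw [← mul_pow, ← map_mul]
      exact (IsLocalization.Away.algebraMap_isUnit (f * g)).pow n
    simp only [u, v, map_add, map_mul, map_pow, map_one, mul_pow,
      ← IsScalarTower.algebraMap_apply C Cf Cfg, ← IsScalarTower.algebraMap_apply C Cg Cfg]
      at hx hy hone hkz
    refine hunit.mul_right_cancel ?_
    linear_combination algebraMap C Cfg g ^ n * hx + algebraMap C Cfg f ^ n * hy +
      algebraMap C Cfg k * hone - hkz

variable {Y : Scheme.{u}} {V W : Y.Opens}

lemma isLocalization_appTop_homOfLE (hV : IsAffineOpen V) (f : Γ(Y, V)) (hWV : W ≤ V)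
    (hW : W = Y.basicOpen f) :
    letI := (Y.homOfLE hWV).appTop.hom.toAlgebra
    IsLocalization.Away (V.topIso.inv f) Γ(W, ⊤) := by
  have hV' : IsAffineOpen (V.ι ''ᵁ ⊤) := by rwa [Scheme.Opens.ι_image_top]
  rw [Scheme.homOfLE_appTop]
  refine hV'.isLocalization_of_eq_basicOpen (V.topIso.inv f) _ ?_
  exact (Scheme.Opens.ι_image_top W).trans (hW.trans (Scheme.basicOpen_res_eq Y f _).symm)

lemma homOfLE_appTop_hom_comp {V' : Y.Opens} (hWV' : W ≤ V') (hV' : V' ≤ V) :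
    (Y.homOfLE (hWV'.trans hV')).appTop.hom =
      (Y.homOfLE hWV').appTop.hom.comp (Y.homOfLE hV').appTop.hom := by
  rw [← CommRingCat.hom_comp, ← Scheme.Hom.comp_appTop, Scheme.homOfLE_homOfLE]

lemma exists_add_of_basicOpen (hV : IsAffineOpen V) (f g : Γ(Y, V))
    (hfg : Y.basicOpen f ⊔ Y.basicOpen g = V) (K : Ideal Γ(V, ⊤))
    {z : Γ((Y.basicOpen f ⊓ Y.basicOpen g : Y.Opens), ⊤)}
    (hz : z ∈ K.map (Y.homOfLE (inf_le_left.trans (Y.basicOpen_le f))).appTop.hom) :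
    ∃ x ∈ K.map (Y.homOfLE (Y.basicOpen_le f)).appTop.hom,
      ∃ y ∈ K.map (Y.homOfLE (Y.basicOpen_le g)).appTop.hom,
        (Y.homOfLE inf_le_left).appTop x + (Y.homOfLE inf_le_right).appTop y = z := by
  have hf : Y.basicOpen f ⊓ Y.basicOpen g ≤ Y.basicOpen f := inf_le_left
  have hg : Y.basicOpen f ⊓ Y.basicOpen g ≤ Y.basicOpen g := inf_le_right
  have hle : Y.basicOpen f ⊓ Y.basicOpen g ≤ V := hf.trans (Y.basicOpen_le f)
  have hspan : Ideal.span {f, g} = ⊤ :=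
    hV.iSup_basicOpen_eq_self_iff.1 (by rw [iSup_subtype, iSup_pair, hfg])
  have hspan' : Ideal.span {V.topIso.inv f, V.topIso.inv g} = ⊤ := by
    rw [← Set.image_pair, ← Ideal.map_span V.topIso.inv.hom, hspan, Ideal.map_top]
  algebraize [(Y.homOfLE (Y.basicOpen_le f)).appTop.hom, (Y.homOfLE (Y.basicOpen_le g)).appTop.hom,
    (Y.homOfLE hle).appTop.hom, (Y.homOfLE hf).appTop.hom, (Y.homOfLE hg).appTop.hom]
  have : IsScalarTower Γ(V, ⊤) Γ(Y.basicOpen f, ⊤)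
      Γ((Y.basicOpen f ⊓ Y.basicOpen g : Y.Opens), ⊤) :=
    .of_algebraMap_eq' (homOfLE_appTop_hom_comp hf (Y.basicOpen_le f))
  have : IsScalarTower Γ(V, ⊤) Γ(Y.basicOpen g, ⊤)
      Γ((Y.basicOpen f ⊓ Y.basicOpen g : Y.Opens), ⊤) :=
    .of_algebraMap_eq' (homOfLE_appTop_hom_comp hg (Y.basicOpen_le g))
  have := isLocalization_appTop_homOfLE hV f (Y.basicOpen_le f) rfl
  have := isLocalization_appTop_homOfLE hV g (Y.basicOpen_le g) rfl
  have := isLocalization_appTop_homOfLE hV (f * g) hle (Y.basicOpen_mul f g).symm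
  rw [map_mul] at this
  exact exists_add_of_isLocalization hspan' K hz

end Localization
section BaseChange

variable {R : Type u} [CommRing R] {X : Scheme.{u}} (f : X ⟶ Spec (.of R))
variable (A : Type u) [CommRing A] [Algebra R A] {B : Type u} [CommRing B] [Algebra R B]

/-- The `A`-algebra structure on the ring of functions on an open subscheme of `X_A`. -/
def structureHom (W : (baseChange f A).Opens) : CommRingCat.of A ⟶ Γ(W, ⊤) :=
  (Scheme.ΓSpecIso (.of A)).inv ≫ (W.ι ≫ pullback.snd f _).appTop

/-- The ideal `nil(A) ^ k Γ(W, 𝒪)`, for `W` open in `X_A`. -/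
def nilIdeal (k : ℕ) (W : (baseChange f A).Opens) : Ideal Γ(W, ⊤) :=
  (nilradical A ^ k).map (structureHom f A W).hom

lemma nilIdeal_one (W : (baseChange f A).Opens) :
    nilIdeal f A 1 W = (nilradical A).map (structureHom f A W).hom := by
  rw [nilIdeal, pow_one]

lemma nilIdeal_mul (j k : ℕ) (W : (baseChange f A).Opens) :
    nilIdeal f A j W * nilIdeal f A k W = nilIdeal f A (j + k) W := by
  rw [nilIdeal, nilIdeal, nilIdeal, ← Ideal.map_mul, pow_add]

lemma nilIdeal_anti {j k : ℕ} (h : j ≤ k) (W : (baseChange f A).Opens) :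
    nilIdeal f A k W ≤ nilIdeal f A j W :=
  Ideal.map_mono (Ideal.pow_le_pow_right h)

lemma isNilpotent_of_mem_nilIdeal {W : (baseChange f A).Opens} {a : Γ(W, ⊤)}
    (ha : a ∈ nilIdeal f A 1 W) : IsNilpotent a := by
  rw [nilIdeal_one] at ha
  exact (Ideal.map_le_iff_le_comap (K := nilradical Γ(W, ⊤))).2
    (fun b hb => IsNilpotent.map hb (structureHom f A W).hom) ha

lemma structureHom_homOfLE {V W : (baseChange f A).Opens} (h : V ≤ W) :
    structureHom f A W ≫ ((baseChange f A).homOfLE h).appTop = structureHom f A V := by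
  rw [structureHom, structureHom, Category.assoc, ← Scheme.Hom.comp_appTop,
    Scheme.homOfLE_ι_assoc]

lemma nilIdeal_map_homOfLE (k : ℕ) {V W : (baseChange f A).Opens} (h : V ≤ W) :
    (nilIdeal f A k W).map ((baseChange f A).homOfLE h).appTop.hom = nilIdeal f A k V := by
  rw [nilIdeal, nilIdeal, Ideal.map_map, ← structureHom_homOfLE f A h, CommRingCat.hom_comp]

variable {A}

lemma isPullback_baseChangeMap (φ : A →ₐ[R] B) :
    IsPullback (baseChangeMap f φ) (pullback.snd f _) (pullback.snd f _)
      (Spec.map (CommRingCat.ofHom φ.toRingHom)) := by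
  refine IsPullback.of_right ?_ (pullback.lift_snd _ _ _)
    (IsPullback.of_hasPullback f (Spec.map (CommRingCat.ofHom (algebraMap R A))))
  have hφ : φ.toRingHom.comp (algebraMap R A) = algebraMap R B := φ.comp_algebraMap
  rw [← Spec.map_comp, ← CommRingCat.ofHom_comp, hφ, baseChangeMap_fst]
  exact IsPullback.of_hasPullback f (Spec.map (CommRingCat.ofHom (algebraMap R B)))

instance (φ : A →ₐ[R] B) : IsAffineHom (baseChangeMap f φ) :=
  MorphismProperty.of_isPullback (isPullback_baseChangeMap f φ).flip inferInstance

lemma isPushout_structureHom (φ : A →ₐ[R] B) {W : (baseChange f A).Opens} (hW : IsAffineOpen W) :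
    IsPushout (structureHom f A W) (CommRingCat.ofHom φ.toRingHom)
      (baseChangeMap f φ ∣_ W).appTop (structureHom f B (baseChangeMap f φ ⁻¹ᵁ W)) := by
  have : IsAffine W := hW
  have h := isPushout_appTop_of_isPullback
    ((isPullback_morphismRestrict (baseChangeMap f φ) W).paste_vert
      (isPullback_baseChangeMap f φ))
  refine h.of_iso (Scheme.ΓSpecIso _) (Iso.refl _) (Scheme.ΓSpecIso _) (Iso.refl _) ?_ ?_ ?_ ?_
  · simp [structureHom]
  · simp
  · exact (Category.comp_id _).trans (Category.id_comp _).symm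
  · simp [structureHom]

lemma flat_structureHom [Flat f] {W : (baseChange f A).Opens} (hW : IsAffineOpen W) :
    (structureHom f A W).hom.Flat := by
  have : IsAffine W := hW
  rw [structureHom, CommRingCat.hom_comp]
  exact RingHom.Flat.comp (.of_bijective (ConcreteCategory.bijective_of_isIso _))
    (W.ι ≫ pullback.snd f _ : W.toScheme ⟶ Spec (CommRingCat.of A)).flat_appTop

lemma nilIdeal_bijOn [Flat f] {φ : A →ₐ[R] B} (hφ : Set.BijOn φ (nilradical A) (nilradical B))
    {W : (baseChange f A).Opens} (hW : IsAffineOpen W) :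
    Set.BijOn (baseChangeMap f φ ∣_ W).appTop (nilIdeal f A 1 W)
      (nilIdeal f B 1 (baseChangeMap f φ ⁻¹ᵁ W)) := by
  rw [nilIdeal_one, nilIdeal_one]
  exact bijOn_map_of_isPushout (isPushout_structureHom f φ hW) (flat_structureHom f hW) hφ

end BaseChange

section Kernel

variable {Y : Scheme.{u}} {F G : SmallSheaf Y}

lemma app_injective_of_mono (g : F ⟶ G) [Mono g] (V : Y.Opens) :
    Function.Injective (g.hom.app (op V)) := by
  intro s t hst
  obtain ⟨s, rfl⟩ := (freeSheafHomEquiv V F).surjective s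
  obtain ⟨t, rfl⟩ := (freeSheafHomEquiv V F).surjective t
  rw [← freeSheafHomEquiv_comp, ← freeSheafHomEquiv_comp] at hst
  rw [(cancel_mono g).1 ((freeSheafHomEquiv V G).injective hst)]

lemma exists_kernelι_app_eq (g : F ⟶ G) {V : Y.Opens} {s : F.obj.obj (op V)}
    (hs : g.hom.app (op V) s = 0) : ∃ t, (kernel.ι g).hom.app (op V) t = s := by
  obtain ⟨s, rfl⟩ := (freeSheafHomEquiv V F).surjective s
  have hsg : s ≫ g = s ≫ 0 := (freeSheafHomEquiv V G).injective <|
    (freeSheafHomEquiv_comp s g).trans (hs.trans (freeSheafHomEquiv_comp s 0).symm)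
  refine ⟨freeSheafHomEquiv V _ (kernel.lift g s (hsg.trans comp_zero)), ?_⟩
  rw [← freeSheafHomEquiv_comp, kernel.lift_ι]

end Kernel

section TildeSheaf

variable {R : Type u} [CommRing R] {X : Scheme.{u}} {f : X ⟶ Spec (.of R)} (E : BigSheaf X)
variable {A : Type u} [CommRing A] [Algebra R A] {W : (baseChange f A).Opens}

/-- The inclusion of the sections of `Ẽ_A` over `W` in those of `E`. -/
def tildeInclusion (W : (baseChange f A).Opens) : (tildeSheaf f E A).obj.obj (op W) →+
    E.obj.obj (op ((opensOver (baseChangeFst f A)).obj W)) :=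
  ((tildeSheafι f E A).hom.app (op W)).hom

variable {E}

lemma tildeInclusion_map {V : (baseChange f A).Opens} (i : V ⟶ W)
    (t : (tildeSheaf f E A).obj.obj (op W)) :
    tildeInclusion E V ((tildeSheaf f E A).obj.map i.op t) =
      E.obj.map ((opensOver (baseChangeFst f A)).map i).op (tildeInclusion E W t) :=
  ConcreteCategory.congr_hom ((tildeSheafι f E A).hom.naturality i.op) t

instance : Mono (tildeSheafι f E A) :=
  inferInstanceAs (Mono (kernel.ι _))

lemma tildeInclusion_injective : Function.Injective (tildeInclusion E W) :=
  app_injective_of_mono (tildeSheafι f E A) W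

lemma mem_range_tildeInclusion_iff
    {s : E.obj.obj (op ((opensOver (baseChangeFst f A)).obj W))} :
    s ∈ (tildeInclusion E W).range ↔
      E.obj.map (preimageOver (redInclusion f A) (baseChangeMap_fst f _) W).op s = 0 := by
  refine ⟨?_, fun hs => exists_kernelι_app_eq (redRestriction f E A) hs⟩
  rintro ⟨t, rfl⟩
  exact ConcreteCategory.congr_hom
    (congrArg (fun g => g.hom.app (op W)) (kernel.condition (redRestriction f E A))) t

end TildeSheaf

section Coordinates

variable {R : Type u} [CommRing R] {X : Scheme.{u}} {f : X ⟶ Spec (.of R)} {E : BigSheaf X}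
variable {A : Type u} [CommRing A] [Algebra R A] {U : X.Opens}

lemma morphismRestrict_redInclusion_eq_zero_iff {W : (baseChange f A).Opens}
    (hW : IsAffineOpen W) (a : Γ(W, ⊤)) :
    (redInclusion f A ∣_ W).appTop a = 0 ↔ a ∈ nilIdeal f A 1 W := by
  rw [nilIdeal_one, ← ker_eq_map_of_isPushout
    (isPushout_structureHom f (Ideal.Quotient.mkₐ R (nilradical A)) hW)]
  exact RingHom.mem_ker.symm

lemma range_opensOver_subset {Y : Scheme.{u}} {p : Y ⟶ X} {W : Y.Opens} (hWU : W ≤ p ⁻¹ᵁ U) :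
    Set.range ((opensOver p).obj W).hom ⊆ U := by
  rintro _ ⟨z, rfl⟩
  exact hWU z.2

lemma preimage_baseChangeMap_le {B : Type u} [CommRing B] [Algebra R B] (φ : A →ₐ[R] B)
    {W : (baseChange f A).Opens} (hWU : W ≤ baseChangeFst f A ⁻¹ᵁ U) :
    baseChangeMap f φ ⁻¹ᵁ W ≤ baseChangeFst f B ⁻¹ᵁ U := by
  rw [← baseChangeMap_fst f φ]
  exact fun y hy => hWU hy

namespace ChartCoordinates

variable (c : ChartCoordinates E U) {V W : (baseChange f A).Opens}
  (hVU : V ≤ baseChangeFst f A ⁻¹ᵁ U) (hWU : W ≤ baseChangeFst f A ⁻¹ᵁ U)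

lemma mem_range_tildeInclusion_iff (hW : IsAffineOpen W)
    {s : E.obj.obj (op ((opensOver (baseChangeFst f A)).obj W))} :
    s ∈ (tildeInclusion E W).range ↔
      ∀ i, c.coord (range_opensOver_subset hWU) s i ∈ nilIdeal f A 1 W := by
  let π := preimageOver (redInclusion f A) (baseChangeMap_fst f _) W
  have hπ := range_opensOver_subset
    (preimage_baseChangeMap_le (Ideal.Quotient.mkₐ R (nilradical A)) hWU)
  have : CompactSpace ((opensOver (baseChangeFst f _)).obj (redInclusion f A ⁻¹ᵁ W)).left :=
    isCompact_iff_compactSpace.1 (hW.preimage (redInclusion f A)).isCompact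
  have coord_eq_zero_iff (i) : c.coord hπ (E.obj.map π.op s) i = 0 ↔
      c.coord (range_opensOver_subset hWU) s i ∈ nilIdeal f A 1 W :=
    (c.coord_map _ hπ π s i).congr_left.trans (morphismRestrict_redInclusion_eq_zero_iff hW _)
  rw [DeformationCohomology.mem_range_tildeInclusion_iff, ← forall_congr' coord_eq_zero_iff]
  refine ⟨fun hs i => ?_, fun hs => c.eq_of_coord_eq hπ fun i => ?_⟩
  · exact (congrArg (c.coord hπ · i) hs).trans (c.coord_zero hπ i)
  · exact (hs i).trans (c.coord_zero hπ i).symm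

/-- The coordinates of a section of `Ẽ_A`. -/
def tildeCoord (t : (tildeSheaf f E A).obj.obj (op W)) (i : Fin c.dim) : Γ(W, ⊤) :=
  c.coord (range_opensOver_subset hWU) (tildeInclusion E W t) i

lemma tildeCoord_zero (i : Fin c.dim) :
    c.tildeCoord hWU (0 : (tildeSheaf f E A).obj.obj (op W)) i = 0 := by
  rw [tildeCoord, map_zero]
  exact c.coord_zero _ i

lemma tildeCoord_mem_nilIdeal (hW : IsAffineOpen W) (t : (tildeSheaf f E A).obj.obj (op W))
    (i : Fin c.dim) : c.tildeCoord hWU t i ∈ nilIdeal f A 1 W :=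
  (c.mem_range_tildeInclusion_iff hWU hW).1 ⟨t, rfl⟩ i

lemma eq_of_tildeCoord_eq (hW : IsAffineOpen W) {t t' : (tildeSheaf f E A).obj.obj (op W)}
    (h : ∀ i, c.tildeCoord hWU t i = c.tildeCoord hWU t' i) : t = t' := by
  have : CompactSpace ((opensOver (baseChangeFst f A)).obj W).left :=
    isCompact_iff_compactSpace.1 hW.isCompact
  exact tildeInclusion_injective (c.eq_of_coord_eq _ h)

lemma exists_tildeCoord_eq (hW : IsAffineOpen W) (a : Fin c.dim → Γ(W, ⊤))
    (ha : ∀ i, a i ∈ nilIdeal f A 1 W) :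
    ∃ t : (tildeSheaf f E A).obj.obj (op W), ∀ i, c.tildeCoord hWU t i = a i := by
  obtain ⟨s, hs⟩ := c.exists_coord_eq (range_opensOver_subset hWU) a
    fun i => isNilpotent_of_mem_nilIdeal f A (ha i)
  obtain ⟨t, rfl⟩ := (c.mem_range_tildeInclusion_iff hWU hW).2 fun i => (hs i).symm ▸ ha i
  exact ⟨t, hs⟩

lemma tildeCoord_map (i : V ⟶ W) (t : (tildeSheaf f E A).obj.obj (op W)) (j : Fin c.dim) :
    c.tildeCoord hVU ((tildeSheaf f E A).obj.map i.op t) j =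
      ((baseChange f A).homOfLE i.le).appTop (c.tildeCoord hWU t j) := by
  rw [tildeCoord, tildeInclusion_map]
  exact c.coord_map _ _ ((opensOver (baseChangeFst f A)).map i) _ j

lemma tildeCoord_sub_add_mem (hW : IsAffineOpen W) {I J : Ideal Γ(W, ⊤)} (hIJ : I * I ≤ J)
    {x y z : (tildeSheaf f E A).obj.obj (op W)} (hx : ∀ i, c.tildeCoord hWU x i ∈ I)
    (hy : ∀ i, c.tildeCoord hWU y i ∈ I)
    (hz : ∀ i, c.tildeCoord hWU z i - (c.tildeCoord hWU x i + c.tildeCoord hWU y i) ∈ J)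
    (i : Fin c.dim) : c.tildeCoord hWU (z - (x + y)) i ∈ J := by
  have : IsAffine ((opensOver (baseChangeFst f A)).obj W).left := hW
  rw [tildeCoord, map_sub, map_add]
  exact c.coord_sub_add_mem (range_opensOver_subset hWU) (I := I) (J := J) hIJ hx hy hz i

end ChartCoordinates

end Coordinates

section CechDecomposition

variable {R : Type u} [CommRing R] {X : Scheme.{u}} {f : X ⟶ Spec (.of R)} {E : BigSheaf X}
variable {A : Type u} [CommRing A] [Algebra R A] {U : X.Opens} {V : (baseChange f A).Opens}

namespace ChartCoordinates

-- The group law is addition of coordinates up to products, which lie in `nil(A) ^ (2 * k) Γ(W)`.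
lemma exists_tildeCoord_sub_add_mem (c : ChartCoordinates E U) (hV : IsAffineOpen V)
    {a b : Γ(baseChange f A, V)}
    (hab : (baseChange f A).basicOpen a ⊔ (baseChange f A).basicOpen b = V)
    (ha : (baseChange f A).basicOpen a ≤ baseChangeFst f A ⁻¹ᵁ U)
    (hb : (baseChange f A).basicOpen b ≤ baseChangeFst f A ⁻¹ᵁ U) {k : ℕ} (hk : 1 ≤ k)
    {z : (tildeSheaf f E A).obj.obj
      (op ((baseChange f A).basicOpen a ⊓ (baseChange f A).basicOpen b))}
    (hz : ∀ i, c.tildeCoord (inf_le_left.trans ha) z i ∈ nilIdeal f A k _) :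
    ∃ (x : (tildeSheaf f E A).obj.obj (op ((baseChange f A).basicOpen a)))
      (y : (tildeSheaf f E A).obj.obj (op ((baseChange f A).basicOpen b))),
      ∀ i, c.tildeCoord (inf_le_left.trans ha)
        (z - ((tildeSheaf f E A).obj.map (homOfLE inf_le_left).op x +
          (tildeSheaf f E A).obj.map (homOfLE inf_le_right).op y)) i ∈ nilIdeal f A (k + 1) _ := by
  have hD : IsAffineOpen ((baseChange f A).basicOpen a ⊓ (baseChange f A).basicOpen b) := by
    rw [← Scheme.basicOpen_mul]
    exact hV.basicOpen _
  have hsplit (i) := exists_add_of_basicOpen hV a b hab (nilIdeal f A k V)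
    (z := c.tildeCoord (inf_le_left.trans ha) z i) (by rw [nilIdeal_map_homOfLE]; exact hz i)
  simp only [nilIdeal_map_homOfLE] at hsplit
  choose x hx y hy hxy using hsplit
  obtain ⟨s, hs⟩ := c.exists_tildeCoord_eq ha (hV.basicOpen a) x
    fun i => nilIdeal_anti f A hk _ (hx i)
  obtain ⟨t, ht⟩ := c.exists_tildeCoord_eq hb (hV.basicOpen b) y
    fun i => nilIdeal_anti f A hk _ (hy i)
  refine ⟨s, t, c.tildeCoord_sub_add_mem _ hD (I := nilIdeal f A k _) ?_
    (fun i => ?_) (fun i => ?_) fun i => ?_⟩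
  · exact (nilIdeal_mul f A k k _).le.trans (nilIdeal_anti f A (by lia) _)
  · rw [c.tildeCoord_map _ ha, hs, ← nilIdeal_map_homOfLE f A k inf_le_left]
    exact Ideal.mem_map_of_mem _ (hx i)
  · rw [c.tildeCoord_map _ hb, ht, ← nilIdeal_map_homOfLE f A k inf_le_right]
    exact Ideal.mem_map_of_mem _ (hy i)
  · rw [c.tildeCoord_map _ ha, c.tildeCoord_map _ hb, hs, ht, hxy, sub_self]
    exact Ideal.zero_mem _

lemma hasCechDecomposition_tildeSheaf (c : ChartCoordinates E U)
    (hA : IsNilpotent (nilradical A)) (hV : IsAffineOpen V) (hVU : V ≤ baseChangeFst f A ⁻¹ᵁ U) :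
    HasCechDecomposition (tildeSheaf f E A) V := by
  intro a b hab z
  obtain ⟨m, hm⟩ := hA
  have ha := ((baseChange f A).basicOpen_le a).trans hVU
  have hb := ((baseChange f A).basicOpen_le b).trans hVU
  have hD : IsAffineOpen ((baseChange f A).basicOpen a ⊓ (baseChange f A).basicOpen b) := by
    rw [← Scheme.basicOpen_mul]
    exact hV.basicOpen _
  suffices ∀ j k, 1 ≤ k → m ≤ j + k → ∀ z : (tildeSheaf f E A).obj.obj (op _),
      (∀ i, c.tildeCoord (inf_le_left.trans ha) z i ∈ nilIdeal f A k _) →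
      ∃ x y, (tildeSheaf f E A).obj.map (homOfLE inf_le_left).op x +
        (tildeSheaf f E A).obj.map (homOfLE inf_le_right).op y = z from
    this m 1 le_rfl (by lia) z (c.tildeCoord_mem_nilIdeal _ hD z)
  intro j
  induction j with
  | zero =>
    intro k _ hmk z hz
    have hbot :
        nilIdeal f A k ((baseChange f A).basicOpen a ⊓ (baseChange f A).basicOpen b) = ⊥ :=
      eq_bot_mono (nilIdeal_anti f A (by lia) _) ((congrArg _ hm).trans Ideal.map_bot)
    have hz0 : z = 0 := c.eq_of_tildeCoord_eq (inf_le_left.trans ha) hD fun i =>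
      ((Submodule.mem_bot _).1 (hbot ▸ hz i)).trans (c.tildeCoord_zero _ i).symm
    exact ⟨0, 0, by rw [map_zero, map_zero, add_zero, hz0]⟩
  | succ j ih =>
    intro k hk hmk z hz
    obtain ⟨x, y, hxy⟩ := c.exists_tildeCoord_sub_add_mem hV hab ha hb hk hz
    obtain ⟨x', y', hxy'⟩ := ih (k + 1) (by lia) (by lia) _ hxy
    exact ⟨x + x', y + y', by rw [map_add, map_add, add_add_add_comm, hxy', add_sub_cancel]⟩

end ChartCoordinates

end CechDecomposition

section ChartOpens

variable {R : Type u} [CommRing R] {X : Scheme.{u}} (f : X ⟶ Spec (.of R)) (E : BigSheaf X)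
variable (A : Type u) [CommRing A] [Algebra R A]

/-- The affine opens of `X_A` lying over an open of `X` on which `E` has coordinates. -/
def chartOpens : Set (baseChange f A).Opens :=
  {V | IsAffineOpen V ∧ ∃ U : X.Opens, Nonempty (ChartCoordinates E U) ∧
    V ≤ baseChangeFst f A ⁻¹ᵁ U}

variable {E}

lemma isBasis_chartOpens (hE : IsFormalLieGroup E) : Opens.IsBasis (chartOpens f E A) := by
  refine Opens.isBasis_iff_nbhd.2 fun {W y} hy => ?_
  obtain ⟨U, hyU, hU⟩ := hE.exists_chartCoordinates (baseChangeFst f A y)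
  obtain ⟨V, hV, hyV, hVW⟩ := exists_isAffineOpen_mem_and_subset
    (U := W ⊓ baseChangeFst f A ⁻¹ᵁ U) ⟨hy, hyU⟩
  exact ⟨V, ⟨hV, U, hU, hVW.trans inf_le_right⟩, hyV, hVW.trans inf_le_left⟩

variable (E)

lemma isBasicOpenStable_chartOpens : IsBasicOpenStable (chartOpens f E A) where
  isAffineOpen hV := hV.1
  basicOpen_mem := by
    rintro V ⟨hV, U, hU, hVU⟩ a
    exact ⟨hV.basicOpen a, U, hU, ((baseChange f A).basicOpen_le a).trans hVU⟩

variable {f E A}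

lemma preimage_mem_chartOpens {B : Type u} [CommRing B] [Algebra R B] (φ : A →ₐ[R] B)
    {V : (baseChange f A).Opens} (hV : V ∈ chartOpens f E A) :
    baseChangeMap f φ ⁻¹ᵁ V ∈ chartOpens f E B := by
  obtain ⟨hV, U, hU, hVU⟩ := hV
  exact ⟨hV.preimage _, U, hU, preimage_baseChangeMap_le φ hVU⟩

lemma isAcyclicOn_tildeSheaf (hA : IsNilpotent (nilradical A)) {V : (baseChange f A).Opens}
    (hV : V ∈ chartOpens f E A) : IsAcyclicOn (tildeSheaf f E A) V :=
  isAcyclicOn_of_hasCechDecomposition (isBasicOpenStable_chartOpens f E A)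
    (fun _ ⟨hV, _, ⟨c⟩, hVU⟩ => c.hasCechDecomposition_tildeSheaf hA hV hVU) hV

end ChartOpens

section Comparison

variable {R : Type u} [CommRing R] {X : Scheme.{u}} (f : X ⟶ Spec (.of R)) (E : BigSheaf X)
variable {A B C : Type u} [CommRing A] [Algebra R A] [CommRing B] [Algebra R B]
  [CommRing C] [Algebra R C]

/-- The map `Ẽ_A ⟶ π_* Ẽ_B` adjoint to `π⁻¹ Ẽ_A ⟶ Ẽ_B`, for `π : X_B ⟶ X_A`. -/
def tildeDirectMap (φ : A →ₐ[R] B) :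
    tildeSheaf f E A ⟶ (directImage (baseChangeMap f φ)).obj (tildeSheaf f E B) :=
  (imageAdjunction (baseChangeMap f φ)).homEquiv _ _ (tildeSheafMap f E φ)

lemma tildeDirectMap_comp_map_tildeSheafι (φ : A →ₐ[R] B) :
    tildeDirectMap f E φ ≫ (directImage (baseChangeMap f φ)).map (tildeSheafι f E B) =
      tildeSheafι f E A ≫ restrictSmallMap E (baseChangeMap f φ) (baseChangeMap_fst f φ) := by
  have hι : tildeSheafMap f E φ ≫ tildeSheafι f E B = _ := kernel.lift_ι _ _ _
  rw [tildeDirectMap, ← Adjunction.homEquiv_naturality_right, hι, Equiv.apply_symm_apply]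

section Bijective

variable {f E} {φ : A →ₐ[R] B} {W : (baseChange f A).Opens}

lemma ChartCoordinates.tildeCoord_tildeDirectMap {U : X.Opens} (c : ChartCoordinates E U)
    (hWU : W ≤ baseChangeFst f A ⁻¹ᵁ U) (t : (tildeSheaf f E A).obj.obj (op W)) (i : Fin c.dim) :
    c.tildeCoord (preimage_baseChangeMap_le φ hWU) ((tildeDirectMap f E φ).hom.app (op W) t) i =
      (baseChangeMap f φ ∣_ W).appTop (c.tildeCoord hWU t i) := by
  have tildeInclusion_eq : tildeInclusion E (baseChangeMap f φ ⁻¹ᵁ W)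
      ((tildeDirectMap f E φ).hom.app (op W) t) =
        E.obj.map (preimageOver (baseChangeMap f φ) (baseChangeMap_fst f φ) W).op
          (tildeInclusion E W t) :=
    ConcreteCategory.congr_hom (congrArg (fun g => g.hom.app (op W))
      (tildeDirectMap_comp_map_tildeSheafι f E φ)) t
  have hWU' := range_opensOver_subset (preimage_baseChangeMap_le φ hWU)
  exact (congrArg (c.coord hWU' · i) tildeInclusion_eq).trans
    (c.coord_map _ _ (preimageOver _ (baseChangeMap_fst f φ) W) _ i)

variable [Flat f]

lemma tildeDirectMap_app_bijective (hφ : Set.BijOn φ (nilradical A) (nilradical B))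
    (hW : W ∈ chartOpens f E A) :
    Function.Bijective ((tildeDirectMap f E φ).hom.app (op W)) := by
  obtain ⟨hW, U, ⟨c⟩, hWU⟩ := hW
  have hWU' := preimage_baseChangeMap_le φ hWU
  have hW' := hW.preimage (baseChangeMap f φ)
  have hnil := nilIdeal_bijOn f hφ hW
  refine ⟨fun t t' htt' => c.eq_of_tildeCoord_eq hWU hW fun i => ?_, fun u => ?_⟩
  · refine hnil.injOn (c.tildeCoord_mem_nilIdeal hWU hW t i)
      (c.tildeCoord_mem_nilIdeal hWU hW t' i) ?_
    rw [← c.tildeCoord_tildeDirectMap, ← c.tildeCoord_tildeDirectMap, htt']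
  · choose a ha hau using fun i => hnil.surjOn (c.tildeCoord_mem_nilIdeal hWU' hW' u i)
    obtain ⟨t, ht⟩ := c.exists_tildeCoord_eq hWU hW a ha
    refine ⟨t, c.eq_of_tildeCoord_eq hWU' hW' fun i => ?_⟩
    rw [c.tildeCoord_tildeDirectMap hWU, ht, hau]

theorem deformationHMap_bijective (hE : IsFormalLieGroup E)
    (hφ : Set.BijOn φ (nilradical A) (nilradical B)) (hB : IsNilpotent (nilradical B)) (q : ℕ) :
    Function.Bijective (deformationHMap f E φ q) := by
  have : IsIso ((imageAdjunction (baseChangeMap f φ)).homEquiv _ _ (tildeSheafMap f E φ)) :=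
    isIso_of_bijective_basis (tildeDirectMap f E φ) <| isBasis_mono (isBasis_chartOpens f A hE)
      fun _ hV => tildeDirectMap_app_bijective hφ hV
  exact cohomologyMap_bijective _ _ (isBasis_mono (isBasis_chartOpens f A hE) fun _ hV =>
    isAcyclicOn_tildeSheaf hB (preimage_mem_chartOpens φ hV)) q

end Bijective

section Functoriality

lemma restrictSmallMap_comp {Y Y' Y'' : Scheme.{u}} {p : Y ⟶ X} {p' : Y' ⟶ X} {p'' : Y'' ⟶ X}
    (h : Y' ⟶ Y) (w : h ≫ p = p') (h' : Y'' ⟶ Y') (w' : h' ≫ p' = p'')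
    (w'' : (h' ≫ h) ≫ p = p'') :
    restrictSmallMap E (h' ≫ h) w'' =
      restrictSmallMap E h w ≫ (directImage h).map (restrictSmallMap E h' w') := by
  apply Sheaf.hom_ext
  ext V : 2
  have preimageOver_comp : preimageOver (h' ≫ h) w'' V.unop =
      preimageOver h' w' (h ⁻¹ᵁ V.unop) ≫ preimageOver h w V.unop := by
    ext1
    exact morphismRestrict_comp h' h V.unop
  exact (congrArg (fun i => E.obj.map i.op) preimageOver_comp).trans (E.obj.map_comp _ _)

lemma cohomologyMap_eq_deformationHMap {h : baseChange f B ⟶ baseChange f A} {φ : A →ₐ[R] B}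
    (hφ : h = baseChangeMap f φ) (w : h ≫ baseChangeFst f A = baseChangeFst f B)
    {α : (inverseImage h).obj (tildeSheaf f E A) ⟶ tildeSheaf f E B}
    (hα : (imageAdjunction h).homEquiv _ _ α ≫ (directImage h).map (tildeSheafι f E B) =
      tildeSheafι f E A ≫ restrictSmallMap E h w) (q : ℕ) :
    cohomologyMap h α q = deformationHMap f E φ q := by
  subst hφ
  have : Mono ((directImage (baseChangeMap f φ)).map (tildeSheafι f E B)) :=
    (Functor.preservesMonomorphisms_of_adjunction (imageAdjunction _)).preserves _
  rw [← tildeDirectMap_comp_map_tildeSheafι, cancel_mono] at hα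
  rw [deformationHMap, ((imageAdjunction _).homEquiv _ _).injective hα]

lemma tildeDirectMap_comp_map_tildeDirectMap (φ : A →ₐ[R] B) (ψ : B →ₐ[R] C)
    (w : (baseChangeMap f ψ ≫ baseChangeMap f φ) ≫ baseChangeFst f A = baseChangeFst f C) :
    (tildeDirectMap f E φ ≫ (directImage (baseChangeMap f φ)).map (tildeDirectMap f E ψ)) ≫
        (directImage (baseChangeMap f φ)).map
          ((directImage (baseChangeMap f ψ)).map (tildeSheafι f E C)) =
      tildeSheafι f E A ≫ restrictSmallMap E (baseChangeMap f ψ ≫ baseChangeMap f φ) w := by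
  rw [Category.assoc, ← Functor.map_comp, tildeDirectMap_comp_map_tildeSheafι, Functor.map_comp,
    ← Category.assoc, tildeDirectMap_comp_map_tildeSheafι, Category.assoc,
    restrictSmallMap_comp E _ (baseChangeMap_fst f φ) _ (baseChangeMap_fst f ψ)]
  rfl

lemma deformationHMap_comp (φ : A →ₐ[R] B) (ψ : B →ₐ[R] C) (q : ℕ) :
    (deformationHMap f E ψ q).comp (deformationHMap f E φ q) =
      deformationHMap f E (ψ.comp φ) q := by
  have w : (baseChangeMap f ψ ≫ baseChangeMap f φ) ≫ baseChangeFst f A = baseChangeFst f C := by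
    rw [baseChangeMap_comp, baseChangeMap_fst]
  let α := (inverseImageComp (baseChangeMap f φ) (baseChangeMap f ψ)).hom.app _ ≫
    (inverseImage (baseChangeMap f ψ)).map (tildeSheafMap f E φ) ≫ tildeSheafMap f E ψ
  have homEquiv_α : (imageAdjunction _).homEquiv _ _ α = tildeDirectMap f E φ ≫
      (directImage (baseChangeMap f φ)).map (tildeDirectMap f E ψ) :=
    homEquiv_inverseImageComp_comp_comp _ _ _ _
  ext x
  refine (cohomologyMap_comp (baseChangeMap f φ) (baseChangeMap f ψ) (tildeSheafMap f E φ)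
    (tildeSheafMap f E ψ) q x).symm.trans (DFunLike.congr_fun
      (cohomologyMap_eq_deformationHMap f E (baseChangeMap_comp f φ ψ) w (α := α) ?_ q) x)
  rw [homEquiv_α]
  exact tildeDirectMap_comp_map_tildeDirectMap f E φ ψ w

end Functoriality

end Comparison

section NilHull

variable {R : Type u} [CommRing R] {A B : Type u} [CommRing A] [Algebra R A] [CommRing B]
  [Algebra R B]

lemma NilHull.toAlgebra_mk (w : Unitization R (nilradical A)) :
    NilHull.toAlgebra R A (Ideal.Quotient.mk _ w) = algebraMap R A w.fst + w.snd := rfl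

lemma NilHull.mk_mem_nilradical_iff {w : Unitization R (nilradical A)} :
    (Ideal.Quotient.mk (nilRelations R A) w ∈ nilradical (NilHull R A)) ↔
      w.fst ∈ nilradical R := by
  have fst_pow (n : ℕ) : (w ^ n).fst = w.fst ^ n :=
    map_pow (Unitization.fstHom R (nilradical A)) w n
  have toAlgebra_pow (n : ℕ) : algebraMap R A (w ^ n).fst + (w ^ n).snd =
      (algebraMap R A w.fst + w.snd) ^ n :=
    map_pow (Unitization.lift (nilInclusion R A)) w n
  refine ⟨fun hw => ?_, fun hw => ?_⟩
  · obtain ⟨n, hn⟩ := mem_nilradical.1 hw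
    rw [← map_pow, Ideal.Quotient.eq_zero_iff_mem] at hn
    exact IsNilpotent.of_pow (fst_pow n ▸ mem_nilradical.1 hn.1)
  · obtain ⟨n, hn⟩ := mem_nilradical.1 <|
      (nilradical A).add_mem (mem_nilradical.2 ((mem_nilradical.1 hw).map (algebraMap R A))) w.snd.2
    refine mem_nilradical.2 ⟨n + 1, ?_⟩
    rw [← map_pow, Ideal.Quotient.eq_zero_iff_mem]
    refine ⟨fst_pow (n + 1) ▸ Ideal.pow_mem_of_mem _ hw _ n.succ_pos, ?_⟩
    refine (neg_eq_of_add_eq_zero_right ?_).symm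
    rw [toAlgebra_pow, pow_succ, hn, zero_mul]

lemma NilHull.bijOn_toAlgebra_nilradical :
    Set.BijOn (NilHull.toAlgebra R A) (nilradical (NilHull R A)) (nilradical A) := by
  refine ⟨fun x hx => IsNilpotent.map hx _, fun x hx y hy hxy => ?_, fun a ha => ?_⟩
  · have hxy_mem := (nilradical (NilHull R A)).sub_mem hx hy
    rw [← sub_eq_zero, ← map_sub] at hxy
    rw [← sub_eq_zero]
    obtain ⟨w, hw⟩ := Ideal.Quotient.mk_surjective (x - y)
    rw [← hw] at hxy hxy_mem ⊢
    rw [NilHull.toAlgebra_mk] at hxy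
    exact Ideal.Quotient.eq_zero_iff_mem.2
      ⟨NilHull.mk_mem_nilradical_iff.1 hxy_mem, (neg_eq_of_add_eq_zero_right hxy).symm⟩
  · refine ⟨Ideal.Quotient.mk _ (Unitization.inr ⟨a, ha⟩), NilHull.mk_mem_nilradical_iff.2 ?_, ?_⟩
    · exact zero_mem _
    · rw [NilHull.toAlgebra_mk, Unitization.fst_inr, map_zero, zero_add, Unitization.snd_inr]

lemma NilHull.toAlgebra_comp_map (φ : A →ₐ[R] B) :
    (NilHull.toAlgebra R B).comp (NilHull.map φ) = φ.comp (NilHull.toAlgebra R A) := by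
  refine Ideal.Quotient.algHom_ext _ (Unitization.algHom_ext'' fun n => ?_)
  change NilHull.toAlgebra R B (Ideal.Quotient.mk _ (Unitization.lift
    ((Unitization.inrNonUnitalAlgHom R (nilradical B)).comp (nilMap φ)) (Unitization.inr n))) =
      φ (NilHull.toAlgebra R A (Ideal.Quotient.mk _ (Unitization.inr n)))
  rw [NilHull.toAlgebra_mk, NilHull.toAlgebra_mk]
  simp [nilMap]

end NilHull

end DeformationCohomology

end

theorem proposition2p2p1_general {R : Type u} [CommRing R] {X : Scheme.{u}}
    (f : X ⟶ Spec (.of R)) [Flat f] (E : BigSheaf X) (hE : IsFormalLieGroup E) (q : ℕ) :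
    (∀ (A : Type u) [CommRing A] [Algebra R A], IsNilpotent (nilradical A) →
      Function.Bijective (nilHullComparison f E A q)) ∧
    (∀ (A B : Type u) [CommRing A] [Algebra R A] [CommRing B] [Algebra R B] (φ : A →ₐ[R] B),
      (deformationHMap f E φ q).comp (nilHullComparison f E A q) =
        (nilHullComparison f E B q).comp (deformationHMap f E (NilHull.map φ) q)) := by
  refine ⟨fun A _ _ hA => ?_, fun A B _ _ _ _ φ => ?_⟩
  · exact deformationHMap_bijective (φ := NilHull.toAlgebra R A) hE
      NilHull.bijOn_toAlgebra_nilradical hA q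
  · rw [nilHullComparison, nilHullComparison, deformationHMap_comp, deformationHMap_comp,
      NilHull.toAlgebra_comp_map]

theorem proposition2p2p1 {R : Type u} [CommRing R] [IsNoetherianRing R]
    {X : Scheme.{u}} [IsNoetherian X] (f : X ⟶ Spec (.of R)) [Flat f]
    (E : BigSheaf X) (hE : IsFormalLieGroup E) (q : ℕ) :
    (∀ (A : Type u) [CommRing A] [Algebra R A] [IsNoetherianRing A],
      Function.Bijective (nilHullComparison f E A q)) ∧
    (∀ (A B : Type u) [CommRing A] [Algebra R A] [IsNoetherianRing A]
      [CommRing B] [Algebra R B] [IsNoetherianRing B] (φ : A →ₐ[R] B),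
      (deformationHMap f E φ q).comp (nilHullComparison f E A q) =
        (nilHullComparison f E B q).comp (deformationHMap f E (NilHull.map φ) q)) :=
  ⟨fun A _ _ _ => (proposition2p2p1_general f E hE q).1 A
      (IsNoetherianRing.isNilpotent_nilradical A),
    fun A B _ _ _ _ _ _ φ => (proposition2p2p1_general f E hE q).2 A B φ⟩
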